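/- Let $\Omega$ be a lattice of rank $2$ in a two-dimensional real vector space $V$, and let $P$ and $Q$ be $\Omega$-polygons, that is, convex hulls of nonempty finite subsets of $\Omega$ (a segment or a single point is allowed). The universal counting function $u_P$ of $P$ assigns to every lattice $\Omega'\supseteq\Omega$ in $V$ the number $u_P(\Omega')=|P\cap\Omega'|$. Let $\Omega^*$ be the dual lattice, consisting of the linear functionals on $V$ that take integer values on $\Omega$. For nonzero $z\in\Omega^*$, let $P(z)$ be the face of $P$ on which $z$ attains its maximum over $P$, and let $|P(z)|$ be its relative length: if $P(z)$ is a segment, it is the length of $P(z)$ divided by the length of a shortest nonzero vector of $\Omega$ parallel to $P(z)$, and if $P(z)$ is a single point, it is $0$. Then $u_P=u_Q$ if and only if the following two conditions hold: (i) $\operatorname{area}(P)=\operatorname{area}(Q)$; (ii) $|P(z)|+|P(-z)|=|Q(z)|+|Q(-z)|$ for every primitive $z\in\Omega^*$. -/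

import Mathlib

open MeasureTheory

section UniversalCounting

variable {V : Type*} [NormedAddCommGroup V] [NormedSpace ℝ V]

/-- `P` is an `Ω`-polytope: the convex hull of a nonempty finite set of points of `Ω`. -/
def IsLatticePolytope (Ω : Submodule ℤ V) (P : Set V) : Prop :=
  ∃ s : Finset V, s.Nonempty ∧ (s : Set V) ⊆ (Ω : Set V) ∧ P = convexHull ℝ (s : Set V)

/-- The set of all lattices of full rank in `V` that contain `Ω`. -/
def superlattices (Ω : Submodule ℤ V) : Set (Submodule ℤ V) :=
  {Λ | Ω ≤ Λ ∧ ∃ _ : DiscreteTopology Λ, IsZLattice ℝ Λ}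

/-- The universal counting function of `P`: it sends a lattice `Λ` containing `Ω` to the number
of points of `Λ` in `P`. -/
noncomputable def universalCount (Ω : Submodule ℤ V) (P : Set V) : superlattices Ω → ℕ :=
  fun Λ => (P ∩ ((Λ : Submodule ℤ V) : Set V)).ncard

/-- The dual lattice of `Ω`: the linear functionals with integer values on `Ω`. -/
def dualLattice (Ω : Submodule ℤ V) : Submodule ℤ (V →L[ℝ] ℝ) where
  carrier := {z | ∀ x ∈ Ω, ∃ k : ℤ, z x = k}
  zero_mem' := fun _ _ => ⟨0, by simp⟩
  add_mem' := by
    intro a b ha hb x hx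
    obtain ⟨k, hk⟩ := ha x hx
    obtain ⟨l, hl⟩ := hb x hx
    exact ⟨k + l, by simp [hk, hl]⟩
  smul_mem' := by
    intro c a ha x hx
    obtain ⟨k, hk⟩ := ha x hx
    exact ⟨c * k, by simp [hk]⟩

/-- A vector `z` of a lattice `L` is primitive if it is nonzero and it is an integer multiple
`k • w` of a vector `w` of `L` only for `k = 1` and `k = -1`. -/
def IsPrimitiveVector {M : Type*} [AddCommGroup M] (L : Submodule ℤ M) (z : M) : Prop :=
  z ∈ L ∧ z ≠ 0 ∧ ∀ (k : ℤ), ∀ w ∈ L, z = k • w → k = 1 ∨ k = -1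

/-- The face `P(z)`: the points of `P` at which the functional `z` is maximal on `P`. -/
def face (P : Set V) (z : V →L[ℝ] ℝ) : Set V :=
  {x ∈ P | ∀ y ∈ P, z y ≤ z x}

/-- The volume of a fundamental domain of the lattice `W ∩ Ω` in the linear subspace `W`, with
respect to the Hausdorff measure on `W` of dimension `dim W`. -/
noncomputable def sectionCovolume [MeasurableSpace V] [BorelSpace V] (Ω : Submodule ℤ V)
    (W : Submodule ℝ V) : ℝ :=
  ZLattice.covolume (ZLattice.comap ℝ Ω W.subtype) (μH[(Module.finrank ℝ W : ℝ)] : Measure W)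

/-- The relative volume of a subset `F` of `V` with respect to the lattice `Ω`. If the affine
hull `H` of `F` is a hyperplane, it is the `(n-1)`-dimensional volume of `F` divided by that of
a fundamental domain of the lattice of the vectors of `Ω` in the direction space of `H`.
Otherwise it is `0`. Both volumes are Hausdorff measures for the same norm; on hyperplanes these
are multiples of Lebesgue measure, and the ratio does not depend on the norm. -/
noncomputable def relVol [MeasurableSpace V] [BorelSpace V] (Ω : Submodule ℤ V) (F : Set V) : ℝ :=
  if Module.finrank ℝ (affineSpan ℝ F).direction + 1 = Module.finrank ℝ V then
    (μH[(Module.finrank ℝ (affineSpan ℝ F).direction : ℝ)] : Measure V).real F /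
      sectionCovolume Ω (affineSpan ℝ F).direction
  else 0

end UniversalCounting

/-! ### Faces of polytopes and their extent along a functional. -/

section Faces

variable {V : Type*} [NormedAddCommGroup V] [NormedSpace ℝ V]

/-! The engine is an unevaluated form of Pick's theorem, obtained by counting column by column. In
coordinates where the counting lattice is `integerPoints`, column `k` contains its length plus two
sawtooth corrections, one for each end (`card_integerPoints_eq`). The column lengths add up to the
area plus half the vertical faces, because the trapezoid rule is exact on unit intervals
(`sum_columnLength_eq`). Along the upper boundary, each edge joins integer points, so it covers a
full period of the sawtooth and contributes its horizontal extent times a weight that depends only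
on its slope (`exists_filter_upperSlope_eq`, `exists_sawtoothSum_eq`). The lower boundary is the
upper boundary of `-P` and has the same weights. So the count is a function of the area and of the
sums over opposite faces (`exists_card_integerPoints_eq`). The values of the weights are never
needed.

Conditions (i) and (ii) therefore determine the count for every superlattice. The only slopes with
nonzero weight are rational, and these come from functionals in the dual lattice of `Ω`;
`exists_relVol_face_eq` converts relative lengths into extents by a factor independent of the
polygon.

Conversely, take coordinates integral on `Ω` and refine the integer lattice by `c` horizontally and
`d` vertically. The count is `d * (c * area + vertical / 2)` up to an error independent of `d`
(`abs_card_integerPoints_sub_le`). Large `d` isolates the bracket, and `c = 1, 2` separate the area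
from the vertical faces (`volume_and_verticalFaces_eq_of_universalCount_eq`). Any primitive `z` can
be made the first coordinate (`exists_adapted_coordinates`), which gives (ii). -/

/-- The length of the smallest interval that contains the image of `F` under `f`. -/
noncomputable def extent (f : V →L[ℝ] ℝ) (F : Set V) : ℝ :=
  sSup (f '' F) - sInf (f '' F)

theorem extent_eq_of_image_eq_Icc {f : V →L[ℝ] ℝ} {F : Set V} {c d : ℝ} (hcd : c ≤ d)
    (h : f '' F = Set.Icc c d) : extent f F = d - c := by
  rw [extent, h, csSup_Icc hcd, csInf_Icc hcd]

theorem extent_segment (f : V →L[ℝ] ℝ) (x y : V) : extent f (segment ℝ x y) = |f y - f x| := by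
  have h : f '' segment ℝ x y = Set.uIcc (f x) (f y) := by
    rw [← segment_eq_uIcc]
    exact image_segment ℝ f.toLinearMap.toAffineMap x y
  rw [extent_eq_of_image_eq_Icc min_le_max h, max_sub_min_eq_abs']
  exact abs_sub_comm _ _

theorem extent_image {W : Type*} [NormedAddCommGroup W] [NormedSpace ℝ W] (T : V ≃L[ℝ] W)
    (f : W →L[ℝ] ℝ) (F : Set V) : extent f (T '' F) = extent (f.comp (T : V →L[ℝ] W)) F := by
  simp only [extent, Set.image_image]
  rfl

theorem face_image {W : Type*} [NormedAddCommGroup W] [NormedSpace ℝ W] (T : V ≃L[ℝ] W)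
    (P : Set V) (z : W →L[ℝ] ℝ) :
    face (T '' P) z = T '' face P (z.comp (T : V →L[ℝ] W)) := by
  ext w
  constructor
  · rintro ⟨⟨x, hx, rfl⟩, h⟩
    exact ⟨x, ⟨hx, fun y hy => h (T y) ⟨y, hy, rfl⟩⟩, rfl⟩
  · rintro ⟨x, ⟨hx, h⟩, rfl⟩
    refine ⟨⟨x, hx, rfl⟩, ?_⟩
    rintro _ ⟨y, hy, rfl⟩
    exact h y hy

theorem face_smul (P : Set V) (z : V →L[ℝ] ℝ) {c : ℝ} (hc : 0 < c) :
    face P (c • z) = face P z := by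
  ext x
  simp [face, hc]

theorem le_of_mem_convexHull {S : Finset V} {f : V →L[ℝ] ℝ} {c : ℝ} (h : ∀ s ∈ S, f s ≤ c)
    {p : V} (hp : p ∈ convexHull ℝ (S : Set V)) : f p ≤ c :=
  convexHull_min (t := {x | f x ≤ c}) (fun s hs => h s hs)
    (convex_halfSpace_le f.toLinearMap.isLinear c) hp

/-- A face of a polytope is the convex hull of the generators in it. -/
theorem face_convexHull (S : Finset V) (z : V →L[ℝ] ℝ) :
    face (convexHull ℝ (S : Set V)) z =
      convexHull ℝ {s | s ∈ S ∧ ∀ t ∈ S, z t ≤ z s} := by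
  classical
  apply Set.Subset.antisymm
  · rintro p ⟨hp, hmax⟩
    obtain ⟨w, hw0, hw1, hwp⟩ := Finset.mem_convexHull'.1 hp
    have hle : ∀ s ∈ S, z s ≤ z p := fun s hs => hmax s (subset_convexHull ℝ _ hs)
    -- A vanishing sum of nonnegative terms: only generators that maximize `z` can carry weight.
    have hz : ∑ s ∈ S, w s * (z p - z s) = 0 := by
      have : z p = ∑ s ∈ S, w s * z s := by
        conv_lhs => rw [← hwp]
        simp
      simp only [mul_sub, Finset.sum_sub_distrib, ← Finset.sum_mul, hw1, ← this]
      simp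
    rw [Finset.sum_eq_zero_iff_of_nonneg
      (fun s hs => mul_nonneg (hw0 s hs) (sub_nonneg.2 (hle s hs)))] at hz
    have hset : {s | s ∈ S ∧ ∀ t ∈ S, z t ≤ z s} =
        ((S.filter fun s => ∀ t ∈ S, z t ≤ z s : Finset V) : Set V) := by
      ext; simp
    rw [hset, Finset.mem_convexHull']
    have hw : ∀ s ∈ S, ¬ (∀ t ∈ S, z t ≤ z s) → w s = 0 := by
      intro s hs h
      by_contra h0
      rcases mul_eq_zero.1 (hz s hs) with h1 | h1
      · exact h0 h1
      · exact h fun t ht => by linarith [hle t ht]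
    refine ⟨w, fun s hs => hw0 s (Finset.mem_filter.1 hs).1, ?_, ?_⟩
    · rw [← hw1]
      refine Finset.sum_subset (Finset.filter_subset _ _) fun s hs h => hw s hs fun h' => h ?_
      exact Finset.mem_filter.2 ⟨hs, h'⟩
    · rw [← hwp]
      refine Finset.sum_subset (Finset.filter_subset _ _) fun s hs h => ?_
      rw [hw s hs fun h' => h (Finset.mem_filter.2 ⟨hs, h'⟩), zero_smul]
  · refine convexHull_min ?_ ?_
    · rintro s ⟨hs, h⟩
      exact ⟨subset_convexHull ℝ _ hs, fun y hy => le_of_mem_convexHull h hy⟩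
    · rintro x ⟨hx, hx'⟩ y ⟨hy, hy'⟩ a b ha hb hab
      refine ⟨convex_convexHull ℝ _ hx hy ha hb hab, fun q hq => ?_⟩
      have h1 := hx' q hq
      have h2 := hy' q hq
      simp only [map_add, map_smul, smul_eq_mul]
      calc z q = a * z q + b * z q := by rw [← add_mul, hab, one_mul]
        _ ≤ _ := by gcongr

/-- A face of a polytope in the plane is a segment between two generators. -/
theorem exists_face_eq_segment {S : Finset V} (hS : S.Nonempty) {z f : V →L[ℝ] ℝ}
    (hzf : ∀ v, z v = 0 → f v = 0 → v = 0) :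
    ∃ x ∈ S, ∃ y ∈ S, face (convexHull ℝ (S : Set V)) z = segment ℝ x y ∧ f x ≤ f y := by
  classical
  obtain ⟨s₀, hs₀, hmax⟩ := S.exists_max_image z hS
  set A := S.filter fun s => ∀ t ∈ S, z t ≤ z s with hA
  have hset : {s | s ∈ S ∧ ∀ t ∈ S, z t ≤ z s} = (A : Set V) := by
    ext; simp [hA]
  have hAne : A.Nonempty := ⟨s₀, Finset.mem_filter.2 ⟨hs₀, hmax⟩⟩
  obtain ⟨x, hx, hxmin⟩ := A.exists_min_image f hAne
  obtain ⟨y, hy, hymax⟩ := A.exists_max_image f hAne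
  have hAz : ∀ s ∈ A, z s = z x := fun s hs => by
    rw [hA, Finset.mem_filter] at hs hx
    exact le_antisymm (hx.2 s hs.1) (hs.2 x hx.1)
  refine ⟨x, (Finset.mem_filter.1 hx).1, y, (Finset.mem_filter.1 hy).1, ?_, hxmin y hy⟩
  rw [face_convexHull, hset]
  apply Set.Subset.antisymm
  · refine convexHull_min (fun s hs => ?_) (convex_segment x y)
    have hs : s ∈ A := hs
    -- The segment has a point `p` with the same `f`-value as `s`. Their `z`-values agree too, and
    -- `z`, `f` together separate points.
    have hfs : f s ∈ f.toLinearMap.toAffineMap '' segment ℝ x y := by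
      rw [image_segment]
      exact Icc_subset_segment ⟨hxmin s hs, hymax s hs⟩
    obtain ⟨p, hp, hpf⟩ := hfs
    have hpz : z p = z x := by
      have : z p ∈ z.toLinearMap.toAffineMap '' segment ℝ x y := ⟨p, hp, rfl⟩
      rw [image_segment] at this
      simpa [hAz y hy] using this
    have : s - p = 0 := hzf _ (by rw [map_sub, hpz, hAz s hs, sub_self])
      (by rw [map_sub, sub_eq_zero]; exact hpf.symm)
    rwa [sub_eq_zero.1 this]
  · rw [← convexHull_pair]
    refine convexHull_mono ?_
    rintro s (rfl | rfl)
    · exact hx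
    · exact hy

end Faces

/-! ### The upper boundary of an integer polygon. -/

section Plane

/-- The lattice of integer points of the plane. -/
def integerPoints : Submodule ℤ (ℝ × ℝ) where
  carrier := {p | ∃ i j : ℤ, p = ((i : ℝ), (j : ℝ))}
  zero_mem' := ⟨0, 0, by simp [Prod.zero_eq_mk]⟩
  add_mem' := by
    rintro _ _ ⟨i, j, rfl⟩ ⟨k, l, rfl⟩
    exact ⟨i + k, j + l, by simp⟩
  smul_mem' := by
    rintro c _ ⟨i, j, rfl⟩
    exact ⟨c * i, c * j, by simp⟩

theorem mem_integerPoints {p : ℝ × ℝ} :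
    p ∈ integerPoints ↔ ∃ i j : ℤ, p = ((i : ℝ), (j : ℝ)) := Iff.rfl

/-- The functional `(x, y) ↦ y - m x`. -/
noncomputable def slopeForm (m : ℝ) : ℝ × ℝ →L[ℝ] ℝ :=
  ContinuousLinearMap.snd ℝ ℝ ℝ - m • ContinuousLinearMap.fst ℝ ℝ ℝ

@[simp] theorem slopeForm_apply (m : ℝ) (p : ℝ × ℝ) : slopeForm m p = p.2 - m * p.1 := by
  simp [slopeForm]

/-- The largest second coordinate of a point of `P` with first coordinate `x`. -/
noncomputable def upper (P : Set (ℝ × ℝ)) (x : ℝ) : ℝ := sSup {y | (x, y) ∈ P}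

/-- The smallest second coordinate of a point of `P` with first coordinate `x`. -/
noncomputable def lower (P : Set (ℝ × ℝ)) (x : ℝ) : ℝ := -upper (-P) (-x)

theorem IsLatticePolytope.isCompact {V : Type*} [NormedAddCommGroup V] [NormedSpace ℝ V]
    {Ω : Submodule ℤ V} {P : Set V} (hP : IsLatticePolytope Ω P) : IsCompact P := by
  obtain ⟨S, -, -, rfl⟩ := hP
  exact S.finite_toSet.isCompact_convexHull ℝ

theorem IsLatticePolytope.convex {V : Type*} [NormedAddCommGroup V] [NormedSpace ℝ V]
    {Ω : Submodule ℤ V} {P : Set V} (hP : IsLatticePolytope Ω P) : Convex ℝ P := by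
  obtain ⟨S, -, -, rfl⟩ := hP
  exact convex_convexHull ℝ _

theorem IsLatticePolytope.image {V W : Type*} [NormedAddCommGroup V] [NormedSpace ℝ V]
    [NormedAddCommGroup W] [NormedSpace ℝ W] {Ω : Submodule ℤ V} {Λ : Submodule ℤ W} {P : Set V}
    (hP : IsLatticePolytope Ω P) (T : V ≃L[ℝ] W) (hT : ∀ x ∈ Ω, T x ∈ Λ) :
    IsLatticePolytope Λ (T '' P) := by
  classical
  obtain ⟨S, hne, hS, rfl⟩ := hP
  refine ⟨S.image T, hne.image _, ?_, ?_⟩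
  · intro y hy
    obtain ⟨x, hx, rfl⟩ := Finset.mem_image.1 hy
    exact hT x (hS hx)
  · rw [Finset.coe_image]
    exact T.toLinearMap.image_convexHull _

theorem IsLatticePolytope.neg {V : Type*} [NormedAddCommGroup V] [NormedSpace ℝ V]
    {Ω : Submodule ℤ V} {P : Set V} (hP : IsLatticePolytope Ω P) : IsLatticePolytope Ω (-P) := by
  have := hP.image (Λ := Ω) (ContinuousLinearEquiv.neg ℝ) (fun x hx => by simpa using hx)
  rwa [← Set.image_neg_eq_neg]

variable {P : Set (ℝ × ℝ)}

theorem IsLatticePolytope.exists_first_bounds (hP : IsLatticePolytope integerPoints P) :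
    ∃ a b : ℤ, IsLeast (Prod.fst '' P) (a : ℝ) ∧ IsGreatest (Prod.fst '' P) (b : ℝ) := by
  obtain ⟨S, hne, hS, rfl⟩ := hP
  obtain ⟨s, hs, hmin⟩ := S.exists_min_image Prod.fst hne
  obtain ⟨t, ht, hmax⟩ := S.exists_max_image Prod.fst hne
  obtain ⟨a, a', rfl⟩ := hS hs
  obtain ⟨b, b', rfl⟩ := hS ht
  refine ⟨a, b, ⟨⟨_, subset_convexHull ℝ _ hs, rfl⟩, ?_⟩, ⟨⟨_, subset_convexHull ℝ _ ht, rfl⟩, ?_⟩⟩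
  · rintro _ ⟨p, hp, rfl⟩
    have := le_of_mem_convexHull (f := -ContinuousLinearMap.fst ℝ ℝ ℝ) (c := -a)
      (fun s hs => neg_le_neg (hmin s hs)) hp
    simpa using this
  · rintro _ ⟨p, hp, rfl⟩
    exact le_of_mem_convexHull (f := ContinuousLinearMap.fst ℝ ℝ ℝ) hmax hp

/-- Needed because facts about the lower boundary are obtained by applying those about the upper
boundary to `-P`. -/
theorem isLeast_fst_neg {b : ℤ} (hb : IsGreatest (Prod.fst '' P) (b : ℝ)) :
    IsLeast (Prod.fst '' (-P)) ((-b : ℤ) : ℝ) := by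
  obtain ⟨⟨p, hp, hpb⟩, hb⟩ := hb
  refine ⟨⟨-p, by simpa using hp, by simp [hpb]⟩, ?_⟩
  rintro _ ⟨q, hq, rfl⟩
  have := hb ⟨-q, hq, rfl⟩
  simp at this ⊢
  linarith

theorem isGreatest_fst_neg {a : ℤ} (ha : IsLeast (Prod.fst '' P) (a : ℝ)) :
    IsGreatest (Prod.fst '' (-P)) ((-a : ℤ) : ℝ) := by
  obtain ⟨⟨p, hp, hpa⟩, ha⟩ := ha
  refine ⟨⟨-p, by simpa using hp, by simp [hpa]⟩, ?_⟩
  rintro _ ⟨q, hq, rfl⟩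
  have := ha ⟨-q, hq, rfl⟩
  simp at this ⊢
  linarith

theorem exists_mk_mem_of_mem_Icc (hc : Convex ℝ P) {a b x : ℝ}
    (ha : IsLeast (Prod.fst '' P) a) (hb : IsGreatest (Prod.fst '' P) b)
    (hx : x ∈ Set.Icc a b) : ∃ y, (x, y) ∈ P := by
  have h : Convex ℝ (Prod.fst '' P) := hc.linear_image (LinearMap.fst ℝ ℝ ℝ)
  obtain ⟨p, hp, rfl⟩ := h.ordConnected.out ha.1 hb.1 hx
  exact ⟨p.2, hp⟩

theorem isGreatest_upper (hk : IsCompact P) {x : ℝ} (hx : ∃ y, (x, y) ∈ P) :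
    IsGreatest {y | (x, y) ∈ P} (upper P x) := by
  have he : Topology.IsClosedEmbedding (fun y : ℝ => (x, y)) :=
    Topology.IsClosedEmbedding.of_continuous_injective_isClosedMap (by fun_prop)
      (fun y y' h => by simpa using h) (isClosedMap_prodMk_left x)
  have : IsCompact {y | (x, y) ∈ P} := he.isCompact_preimage hk
  exact this.isGreatest_sSup hx

theorem mk_upper_mem (hk : IsCompact P) {x : ℝ} (hx : ∃ y, (x, y) ∈ P) : (x, upper P x) ∈ P :=
  (isGreatest_upper hk hx).1

theorem le_upper (hk : IsCompact P) {x y : ℝ} (hx : (x, y) ∈ P) : y ≤ upper P x :=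
  (isGreatest_upper hk ⟨y, hx⟩).2 hx

theorem mk_lower_mem (hk : IsCompact P) {x : ℝ} (hx : ∃ y, (x, y) ∈ P) : (x, lower P x) ∈ P := by
  obtain ⟨y, hy⟩ := hx
  have := mk_upper_mem (P := -P) (x := -x) (by simpa using hk.neg) ⟨-y, by simpa using hy⟩
  simpa [lower] using this

theorem lower_le (hk : IsCompact P) {x y : ℝ} (hx : (x, y) ∈ P) : lower P x ≤ y := by
  have := le_upper (P := -P) (x := -x) (y := -y) (by simpa using hk.neg) (by simpa using hx)
  rw [lower]
  linarith

theorem mk_mem_iff (hk : IsCompact P) (hc : Convex ℝ P) {x : ℝ} (hx : ∃ y, (x, y) ∈ P) {y : ℝ} :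
    (x, y) ∈ P ↔ y ∈ Set.Icc (lower P x) (upper P x) := by
  refine ⟨fun h => ⟨lower_le hk h, le_upper hk h⟩, fun h => ?_⟩
  have h2 : Convex ℝ {y | (x, y) ∈ P} := by
    intro u hu v hv s t hs ht hst
    have := hc hu hv hs ht hst
    simpa [← add_mul, hst] using this
  exact h2.ordConnected.out (mk_lower_mem hk hx) (mk_upper_mem hk hx) h

/-- The line through two integer points, at most `k` and at least `k + 1` in the first coordinate,
that is highest over `k + 1 / 2`, lies above the whole polygon. -/
theorem exists_supporting_pair {S : Finset (ℝ × ℝ)} (hS : (S : Set (ℝ × ℝ)) ⊆ integerPoints)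
    {k : ℤ} (hl : ∃ s ∈ S, s.1 ≤ k) (hr : ∃ t ∈ S, (k : ℝ) + 1 ≤ t.1) :
    ∃ s ∈ S, ∃ t ∈ S, ∃ m : ℝ, s.1 ≤ k ∧ (k : ℝ) + 1 ≤ t.1 ∧ slopeForm m s = slopeForm m t ∧
      ∀ r ∈ S, slopeForm m r ≤ slopeForm m s := by
  classical
  set A := S.filter fun s => s.1 ≤ (k : ℝ)
  set B := S.filter fun s => (k : ℝ) + 1 ≤ s.1
  -- Any abscissa strictly between `k` and `k + 1` would serve.
  set c : ℝ := k + 1 / 2 with hcdef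
  have hAB : (A ×ˢ B).Nonempty := by
    obtain ⟨s, hs, hsk⟩ := hl
    obtain ⟨t, ht, htk⟩ := hr
    exact ⟨(s, t), by simp [A, B, hs, ht, hsk, htk]⟩
  -- The maximized quantity is the height over `c` of the line through the two points. A generator
  -- above the optimal line could replace `s` or `t` and raise that height.
  obtain ⟨⟨s, t⟩, hst, hmax⟩ := (A ×ˢ B).exists_max_image
    (fun q => (q.1.2 * (q.2.1 - c) + q.2.2 * (c - q.1.1)) / (q.2.1 - q.1.1)) hAB
  simp only [Finset.mem_product, A, B, Finset.mem_filter] at hst hmax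
  obtain ⟨⟨hs, hsk⟩, ht, htk⟩ := hst
  have hd : 0 < t.1 - s.1 := by linarith
  set m := (t.2 - s.2) / (t.1 - s.1) with hm
  have hmd : m * (t.1 - s.1) = t.2 - s.2 := div_mul_cancel₀ _ hd.ne'
  refine ⟨s, hs, t, ht, m, hsk, htk, by simp only [slopeForm_apply]; linarith, fun r hr => ?_⟩
  have hh : (s.2 * (t.1 - c) + t.2 * (c - s.1)) / (t.1 - s.1) = s.2 + m * (c - s.1) := by
    rw [div_eq_iff hd.ne']
    linear_combination (-(c - s.1)) * hmd
  simp only [slopeForm_apply]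
  have hrk : r.1 ≤ k ∨ (k : ℝ) + 1 ≤ r.1 := by
    obtain ⟨i, j, rfl⟩ := hS hr
    rcases le_or_gt i k with h | h
    · left
      change (i : ℝ) ≤ k
      exact_mod_cast h
    · right
      change (k : ℝ) + 1 ≤ i
      exact_mod_cast h
  rcases hrk with h | h
  · have h1 := hmax (r, t) ⟨⟨hr, h⟩, ht, htk⟩
    rw [hh, div_le_iff₀ (by linarith)] at h1
    have h2 : 0 ≤ (t.1 - c) * (s.2 - m * s.1 - (r.2 - m * r.1)) := by
      linear_combination h1 + (c - r.1) * hmd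
    have := nonneg_of_mul_nonneg_right h2 (by linarith)
    linarith
  · have h1 := hmax (s, r) ⟨⟨hs, hsk⟩, hr, h⟩
    rw [hh, div_le_iff₀ (by linarith)] at h1
    have h2 : 0 ≤ (c - s.1) * (s.2 - m * s.1 - (r.2 - m * r.1)) := by
      linear_combination h1
    have := nonneg_of_mul_nonneg_right h2 (by linarith)
    linarith

/-- Convexity puts the chord from `p` to `q` inside `P`, and the supporting line through it bounds
`P` from above. -/
theorem upper_eq_of_mem_face (hk : IsCompact P) {m : ℝ} {p q : ℝ × ℝ} (hc : Convex ℝ P)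
    (hp : p ∈ face P (slopeForm m)) (hq : q ∈ face P (slopeForm m)) {x : ℝ} (hpx : p.1 ≤ x)
    (hxq : x ≤ q.1) : upper P x = p.2 + m * (x - p.1) := by
  have hpq : slopeForm m q = slopeForm m p := le_antisymm (hp.2 q hq.1) (hq.2 p hp.1)
  simp only [slopeForm_apply] at hpq
  have hmem : (x, p.2 + m * (x - p.1)) ∈ P := by
    have hx : x ∈ (LinearMap.fst ℝ ℝ ℝ).toAffineMap '' segment ℝ p q := by
      rw [image_segment]
      exact Icc_subset_segment ⟨hpx, hxq⟩
    obtain ⟨r, hr, hrx⟩ := hx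
    have hr2 : r.2 - m * r.1 = p.2 - m * p.1 := by
      have : slopeForm m r ∈ (slopeForm m).toLinearMap.toAffineMap '' segment ℝ p q :=
        ⟨r, hr, rfl⟩
      rw [image_segment] at this
      simpa [hpq] using this
    have : r = (x, p.2 + m * (x - p.1)) := by
      refine Prod.ext hrx ?_
      have : r.1 = x := hrx
      rw [this] at hr2
      simp only
      linarith
    rw [← this]
    exact hc.segment_subset hp.1 hq.1 hr
  refine le_antisymm ?_ (le_upper hk hmem)
  have := hp.2 _ (mk_upper_mem hk ⟨_, hmem⟩)
  simp only [slopeForm_apply] at this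
  linarith

/-- The difference of the heights of the upper boundary over `k + 1` and `k`. -/
noncomputable def upperSlope (P : Set (ℝ × ℝ)) (k : ℤ) : ℝ := upper P (k + 1) - upper P k

/-- Generators have integer abscissae, so none lies strictly over the unit interval and a single
edge spans it. Its slope is then the height difference. -/
theorem exists_mem_face_upperSlope (hP : IsLatticePolytope integerPoints P) {a b k : ℤ}
    (ha : IsLeast (Prod.fst '' P) (a : ℝ)) (hb : IsGreatest (Prod.fst '' P) (b : ℝ))
    (hk : k ∈ Finset.Ico a b) :
    ∃ s ∈ face P (slopeForm (upperSlope P k)), ∃ t ∈ face P (slopeForm (upperSlope P k)),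
      s.1 ≤ k ∧ (k : ℝ) + 1 ≤ t.1 := by
  have hcp := hP.isCompact
  have hcv := hP.convex
  obtain ⟨S, hne, hS, rfl⟩ := hP
  rw [Finset.mem_Ico] at hk
  have hl : ∃ s ∈ S, s.1 ≤ k := by
    by_contra! h
    obtain ⟨p, hp, hpa⟩ := ha.1
    obtain ⟨s, hs, hmin⟩ := S.exists_min_image Prod.fst hne
    have := le_of_mem_convexHull (f := -ContinuousLinearMap.fst ℝ ℝ ℝ) (c := -s.1)
      (fun s hs => neg_le_neg (hmin s hs)) hp
    have h2 := h s hs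
    have h3 : (a : ℝ) ≤ k := by exact_mod_cast hk.1
    simp at this
    linarith
  have hr : ∃ s ∈ S, (k : ℝ) + 1 ≤ s.1 := by
    by_contra! h
    obtain ⟨p, hp, hpa⟩ := hb.1
    obtain ⟨s, hs, hmax⟩ := S.exists_max_image Prod.fst hne
    have := le_of_mem_convexHull (f := ContinuousLinearMap.fst ℝ ℝ ℝ) (c := s.1) hmax hp
    have h2 := h s hs
    have h3 : (k : ℝ) + 1 ≤ b := by exact_mod_cast hk.2
    simp at this
    linarith
  obtain ⟨s, hs, t, ht, m, hsk, htk, hst, hmax⟩ := exists_supporting_pair hS hl hr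
  have hsf : s ∈ face (convexHull ℝ (S : Set (ℝ × ℝ))) (slopeForm m) :=
    ⟨subset_convexHull ℝ _ hs, fun y hy => le_of_mem_convexHull hmax hy⟩
  have htf : t ∈ face (convexHull ℝ (S : Set (ℝ × ℝ))) (slopeForm m) :=
    ⟨subset_convexHull ℝ _ ht, fun y hy => hst ▸ le_of_mem_convexHull hmax hy⟩
  have hm : upperSlope (convexHull ℝ (S : Set (ℝ × ℝ))) k = m := by
    rw [upperSlope, upper_eq_of_mem_face hcp hcv hsf htf (x := k + 1) (by linarith) (by linarith),
      upper_eq_of_mem_face hcp hcv hsf htf (x := k) (by linarith) (by linarith)]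
    ring
  rw [hm]
  exact ⟨s, hsf, t, htf, hsk, htk⟩

theorem upper_eq_of_mem_Icc (hP : IsLatticePolytope integerPoints P) {a b k : ℤ}
    (ha : IsLeast (Prod.fst '' P) (a : ℝ)) (hb : IsGreatest (Prod.fst '' P) (b : ℝ))
    (hk : k ∈ Finset.Ico a b) {x : ℝ} (hx : x ∈ Set.Icc (k : ℝ) (k + 1)) :
    upper P x = upper P k + upperSlope P k * (x - k) := by
  obtain ⟨s, hs, t, ht, hsk, htk⟩ := exists_mem_face_upperSlope hP ha hb hk
  rw [upper_eq_of_mem_face hP.isCompact hP.convex hs ht (x := x) (by linarith [hx.1])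
      (by linarith [hx.2]),
    upper_eq_of_mem_face hP.isCompact hP.convex hs ht (x := k) hsk (by linarith)]
  ring

/-- The unit intervals over which the upper boundary has slope `m` make up the projection of the
face with normal `(-m, 1)`. -/
theorem exists_filter_upperSlope_eq (hP : IsLatticePolytope integerPoints P) {a b : ℤ}
    (ha : IsLeast (Prod.fst '' P) (a : ℝ)) (hb : IsGreatest (Prod.fst '' P) (b : ℝ)) (m : ℝ) :
    ∃ x y u v : ℤ, x ≤ y ∧ (Finset.Ico a b).filter (fun k => upperSlope P k = m) = Finset.Ico x y ∧
      extent (ContinuousLinearMap.fst ℝ ℝ ℝ) (face P (slopeForm m)) = y - x ∧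
      (∀ k ∈ Finset.Icc x y, upper P k = u + m * (k - x)) ∧ m * (y - x) = v := by
  have hcp := hP.isCompact
  have hcv := hP.convex
  have hP' := hP
  obtain ⟨S, hne, hS, rfl⟩ := hP'
  obtain ⟨s, hs, t, ht, hface, hle⟩ := exists_face_eq_segment hne (z := slopeForm m)
    (f := ContinuousLinearMap.fst ℝ ℝ ℝ) (fun v h1 h2 => by
      have h2 : v.1 = 0 := h2
      rw [slopeForm_apply, h2] at h1
      exact Prod.ext h2 (by simpa using h1))
  have hext := extent_segment (ContinuousLinearMap.fst ℝ ℝ ℝ) s t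
  rw [← hface, abs_of_nonneg (sub_nonneg.2 hle)] at hext
  have hsf : s ∈ face _ (slopeForm m) := hface ▸ left_mem_segment ℝ s t
  have htf : t ∈ face _ (slopeForm m) := hface ▸ right_mem_segment ℝ s t
  obtain ⟨x, u, rfl⟩ := hS hs
  obtain ⟨y, w, rfl⟩ := hS ht
  have hxy : x ≤ y := by simpa using hle
  have hup : ∀ z : ℝ, x ≤ z → z ≤ y → upper (convexHull ℝ (S : Set (ℝ × ℝ))) z
      = u + m * (z - x) := fun z h1 h2 => upper_eq_of_mem_face hcp hcv hsf htf h1 h2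
  -- The witnesses are the abscissae of the two ends of the face, the height of the left end, and
  -- the rise. If the face is a point, then `x = y` and the interval is empty.
  refine ⟨x, y, u, w - u, hxy, ?_, by simpa using hext, ?_, ?_⟩
  · ext k
    simp only [Finset.mem_filter, Finset.mem_Ico]
    constructor
    · rintro ⟨hk, rfl⟩
      obtain ⟨p, hp, q, hq, hpk, hqk⟩ := exists_mem_face_upperSlope hP ha hb
        (Finset.mem_Ico.2 hk)
      have key : ∀ r ∈ segment ℝ ((x : ℝ), (u : ℝ)) ((y : ℝ), (w : ℝ)),
          (x : ℝ) ≤ r.1 ∧ r.1 ≤ y := by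
        intro r hr
        have : r.1 ∈ (LinearMap.fst ℝ ℝ ℝ).toAffineMap '' segment ℝ ((x : ℝ), (u : ℝ))
          ((y : ℝ), (w : ℝ)) := ⟨r, hr, rfl⟩
        rw [image_segment] at this
        exact segment_subset_Icc hle this
      rw [hface] at hp hq
      have h1 := (key p hp).1.trans hpk
      have h2 := hqk.trans (key q hq).2
      exact ⟨by exact_mod_cast h1, by exact_mod_cast h2⟩
    · rintro ⟨h1, h2⟩
      have h3 := ha.2 ⟨_, hsf.1, rfl⟩
      have h4 := hb.2 ⟨_, htf.1, rfl⟩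
      simp only [Int.cast_le] at h3 h4
      refine ⟨⟨h3.trans h1, h2.trans_le h4⟩, ?_⟩
      have h5 : (x : ℝ) ≤ k := by exact_mod_cast h1
      have h6 : (k : ℝ) + 1 ≤ y := by exact_mod_cast h2
      rw [upperSlope, hup _ (by linarith) h6, hup _ h5 (by linarith)]
      ring
  · intro k hk
    rw [Finset.mem_Icc] at hk
    exact hup k (by exact_mod_cast hk.1) (by exact_mod_cast hk.2)
  · have h1 := hup y (by exact_mod_cast hxy) le_rfl
    have h2 := upper_eq_of_mem_face hcp hcv htf htf (x := y) le_rfl le_rfl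
    push_cast
    simp at h2
    linarith

end Plane

/-! ### Sawtooth sums over arithmetic progressions. -/

section Sawtooth

/-- The centred sawtooth function. -/
noncomputable def sawtooth (t : ℝ) : ℝ := ⌊t⌋ - t + 1 / 2

theorem sawtooth_int_add (n : ℤ) (t : ℝ) : sawtooth (n + t) = sawtooth t := by
  simp only [sawtooth, Int.floor_intCast_add]
  push_cast
  ring

theorem abs_sawtooth_le (t : ℝ) : |sawtooth t| ≤ 1 / 2 := by
  rw [sawtooth, abs_le]
  constructor <;> linarith [Int.floor_le t, Int.lt_floor_add_one t]

/-- Since `m * N` is an integer, `N` is a period of `j ↦ sawtooth (m * j)`. -/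
theorem sum_sawtooth_mul {m : ℝ} {N : ℕ} {i : ℤ} (h : m * N = i) (K : ℕ) :
    ∑ j ∈ Finset.range (N * K), sawtooth (m * j) =
      K * ∑ j ∈ Finset.range N, sawtooth (m * j) := by
  induction K with
  | zero => simp
  | succ K ih =>
    rw [Nat.mul_succ, Finset.sum_range_add, ih]
    have : ∀ j ∈ Finset.range N, sawtooth (m * ((N * K + j : ℕ) : ℝ)) = sawtooth (m * j) := by
      intro j _
      rw [← sawtooth_int_add (i * K) (m * j)]
      congr 1
      push_cast
      rw [← h]
      ring
    rw [Finset.sum_congr rfl this]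
    push_cast
    ring

/-- Two periods `N` and `K` have the same mean because both can be compared with the period `N * K`.
Without a positive period only `N = 0` has to be checked, and `c = 0` is chosen so that a nonzero
mean forces `m` to be rational. -/
theorem exists_sum_sawtooth_eq (m : ℝ) :
    ∃ c : ℝ, (∀ (N : ℕ) (i : ℤ), m * N = i → ∑ j ∈ Finset.range N, sawtooth (m * j) = N * c) ∧
      (c ≠ 0 → ∃ (N : ℕ) (i : ℤ), 0 < N ∧ m * N = i) := by
  by_cases h : ∃ (N : ℕ) (i : ℤ), 0 < N ∧ m * N = i
  · have h' := h
    obtain ⟨N, i, hN, h⟩ := h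
    refine ⟨(∑ j ∈ Finset.range N, sawtooth (m * j)) / N, fun K l hK => ?_, fun _ => h'⟩
    have h1 := sum_sawtooth_mul h K
    rw [mul_comm, sum_sawtooth_mul hK N] at h1
    have : (N : ℝ) ≠ 0 := by exact_mod_cast hN.ne'
    field_simp
    linarith
  · refine ⟨0, fun N i hN => ?_, fun h0 => absurd rfl h0⟩
    push Not at h
    rcases Nat.eq_zero_or_pos N with rfl | h0
    · simp
    · exact absurd hN (h N i h0)

/-- The mean value of the sawtooth function on the arithmetic progression `m j` with `j` in a
full period, for rational `m`, and `0` for irrational `m`. -/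
noncomputable def sawtoothMean (m : ℝ) : ℝ := (exists_sum_sawtooth_eq m).choose

theorem sum_sawtooth_eq {m : ℝ} {N : ℕ} {i : ℤ} (h : m * N = i) :
    ∑ j ∈ Finset.range N, sawtooth (m * j) = N * sawtoothMean m :=
  (exists_sum_sawtooth_eq m).choose_spec.1 N i h

theorem exists_mul_eq_of_sawtoothMean_ne_zero {m : ℝ} (h : sawtoothMean m ≠ 0) :
    ∃ (N : ℕ) (i : ℤ), 0 < N ∧ m * N = i :=
  (exists_sum_sawtooth_eq m).choose_spec.2 h

theorem sum_Ico_int_eq_sum_range {x y : ℤ} (h : x ≤ y) (g : ℤ → ℝ) :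
    ∑ k ∈ Finset.Ico x y, g k = ∑ j ∈ Finset.range (y - x).toNat, g (x + j) := by
  symm
  refine Finset.sum_bij (fun j _ => x + (j : ℤ)) ?_ ?_ ?_ ?_
  · intro j hj
    simp only [Finset.mem_range, Finset.mem_Ico] at *
    lia
  · intro i _ j _ hij
    lia
  · intro k hk
    simp only [Finset.mem_Ico] at hk
    refine ⟨(k - x).toNat, ?_, ?_⟩
    · simp only [Finset.mem_range]
      lia
    · lia
  · intro j _
    rfl

theorem sum_Icc_int_eq_add {a b : ℤ} (h : a ≤ b) (g : ℤ → ℝ) :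
    ∑ k ∈ Finset.Icc a b, g k = g b + ∑ k ∈ Finset.Ico a b, g k := by
  rw [← Finset.Ico_insert_right h, Finset.sum_insert (by simp)]

theorem sum_Icc_int_neg (a b : ℤ) (g : ℤ → ℝ) :
    ∑ k ∈ Finset.Icc a b, g (-k) = ∑ k ∈ Finset.Icc (-b) (-a), g k := by
  refine Finset.sum_bij (fun k _ => -k) ?_ ?_ ?_ ?_
  · intro k hk
    simp only [Finset.mem_Icc] at *
    lia
  · intro i _ j _ hij
    lia
  · intro k hk
    simp only [Finset.mem_Icc] at *
    exact ⟨-k, by lia, by lia⟩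
  · intro k _
    rfl

end Sawtooth

/-! ### Counting integer points by columns. -/

section Columns

variable {P : Set (ℝ × ℝ)}

theorem IsLeast.le_of_isGreatest_fst {a b : ℤ} (ha : IsLeast (Prod.fst '' P) (a : ℝ))
    (hb : IsGreatest (Prod.fst '' P) (b : ℝ)) : a ≤ b := by
  exact_mod_cast ha.2 hb.1

/-- The top of the last column is an end of the right vertical face, hence a generator. -/
theorem exists_upper_eq_int (hP : IsLatticePolytope integerPoints P) {b : ℤ}
    (hb : IsGreatest (Prod.fst '' P) (b : ℝ)) : ∃ n : ℤ, upper P b = n := by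
  have hcp := hP.isCompact
  have hex : ∃ y, ((b : ℝ), y) ∈ P := by
    obtain ⟨p, hp, hpb⟩ := hb.1
    exact ⟨p.2, by rw [← hpb]; exact hp⟩
  have hmem := mk_upper_mem hcp hex
  obtain ⟨S, hne, hS, rfl⟩ := hP
  obtain ⟨s, hs, t, ht, hface, hle⟩ := exists_face_eq_segment hne
    (z := ContinuousLinearMap.fst ℝ ℝ ℝ)
    (f := ContinuousLinearMap.snd ℝ ℝ ℝ) (fun v h1 h2 => Prod.ext h1 h2)
  have hu : ((b : ℝ), upper (convexHull ℝ (S : Set (ℝ × ℝ))) b) ∈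
      face (convexHull ℝ (S : Set (ℝ × ℝ))) (ContinuousLinearMap.fst ℝ ℝ ℝ) :=
    ⟨hmem, fun y hy => hb.2 ⟨y, hy, rfl⟩⟩
  have htf : t ∈ face _ (ContinuousLinearMap.fst ℝ ℝ ℝ) := hface ▸ right_mem_segment ℝ s t
  have htb : t.1 = b := le_antisymm (hu.2 _ htf.1) (htf.2 _ hu.1)
  obtain ⟨i, j, hij⟩ := hS ht
  refine ⟨j, ?_⟩
  have hj : t.2 = j := by rw [hij]
  rw [← hj]
  apply le_antisymm
  · rw [hface] at hu
    have : upper (convexHull ℝ (S : Set (ℝ × ℝ))) b ∈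
      (LinearMap.snd ℝ ℝ ℝ).toAffineMap '' segment ℝ s t := ⟨_, hu, rfl⟩
    rw [image_segment] at this
    exact (segment_subset_Icc hle this).2
  · refine le_upper hcp ?_
    rw [← htb]
    exact htf.1

/-- The sum of the sawtooth function along the upper boundary, over the integer columns. -/
noncomputable def sawtoothSum (P : Set (ℝ × ℝ)) (a b : ℤ) : ℝ :=
  ∑ k ∈ Finset.Icc a b, sawtooth (upper P k)

theorem abs_sawtoothSum_le {a b : ℤ} (h : a ≤ b) : |sawtoothSum P a b| ≤ (b - a + 1) / 2 := by
  refine (Finset.abs_sum_le_sum_abs _ _).trans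
    ((Finset.sum_le_card_nsmul (Finset.Icc a b) (fun k : ℤ => |sawtooth (upper P k)|) _
      fun k _ => abs_sawtooth_le (upper P k)).trans ?_)
  rw [Int.card_Icc, nsmul_eq_mul]
  have : (((b + 1 - a).toNat : ℤ) : ℝ) = ((b + 1 - a : ℤ) : ℝ) := by
    rw [Int.toNat_of_nonneg (by lia)]
  rw [Int.cast_natCast] at this
  rw [this]
  push_cast
  linarith

/-- Group the unit intervals by slope. Slopes that do not occur contribute zero, so any larger `M'`
is allowed; this lets both boundaries and both polygons share one index set. -/
theorem exists_sawtoothSum_eq (hP : IsLatticePolytope integerPoints P) {a b : ℤ}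
    (ha : IsLeast (Prod.fst '' P) (a : ℝ)) (hb : IsGreatest (Prod.fst '' P) (b : ℝ)) :
    ∃ M : Finset ℝ, ∀ M', M ⊆ M' → sawtoothSum P a b = 1 / 2 +
      ∑ m ∈ M', extent (ContinuousLinearMap.fst ℝ ℝ ℝ) (face P (slopeForm m)) *
        sawtoothMean m := by
  classical
  refine ⟨(Finset.Ico a b).image (upperSlope P), fun M' hM => ?_⟩
  -- There is one more column than unit intervals. The last column has an integer top and supplies
  -- the `1 / 2`; each other column belongs to the interval on its right.
  rw [sawtoothSum, sum_Icc_int_eq_add (ha.le_of_isGreatest_fst hb)]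
  congr 1
  · obtain ⟨n, hn⟩ := exists_upper_eq_int hP hb
    rw [hn, ← add_zero (n : ℝ), sawtooth_int_add]
    simp [sawtooth]
  · rw [← Finset.sum_fiberwise_of_maps_to (t := M') (g := upperSlope P)
      (fun k hk => hM (Finset.mem_image_of_mem _ hk))]
    refine Finset.sum_congr rfl fun m _ => ?_
    obtain ⟨x, y, u, v, hxy, hfilter, hext, hup, hv⟩ := exists_filter_upperSlope_eq hP ha hb m
    rw [hfilter, hext, sum_Ico_int_eq_sum_range hxy]
    have hcast : (((y - x).toNat : ℕ) : ℝ) = y - x := by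
      have : (((y - x).toNat : ℤ) : ℝ) = ((y - x : ℤ) : ℝ) := by
        rw [Int.toNat_of_nonneg (by lia)]
      rw [Int.cast_natCast] at this
      rw [this]
      push_cast
      ring
    rw [← hcast, ← sum_sawtooth_eq (i := v) (by rw [hcast, hv])]
    refine Finset.sum_congr rfl fun j hj => ?_
    rw [Finset.mem_range] at hj
    rw [hup _ (Finset.mem_Icc.2 (by lia)), sawtooth_int_add]
    push_cast
    congr 1
    ring

/-- The length of the vertical section of `P` over `x`. -/
noncomputable def columnLength (P : Set (ℝ × ℝ)) (x : ℝ) : ℝ := upper P x - lower P x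

/-- A column holds `⌊upper⌋ + 1 - ⌈lower⌉` points, and `⌈lower⌉ = -⌊-lower⌋` makes the two ends
symmetric. -/
theorem card_integerPoints_eq (hP : IsLatticePolytope integerPoints P) {a b : ℤ}
    (ha : IsLeast (Prod.fst '' P) (a : ℝ)) (hb : IsGreatest (Prod.fst '' P) (b : ℝ)) :
    ((P ∩ (integerPoints : Set (ℝ × ℝ))).ncard : ℝ) =
      ∑ k ∈ Finset.Icc a b, columnLength P k + sawtoothSum P a b +
        sawtoothSum (-P) (-b) (-a) := by
  classical
  have hk := hP.isCompact
  have hc := hP.convex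
  have hex : ∀ k ∈ Finset.Icc a b, ∃ y, ((k : ℝ), y) ∈ P := fun k hkab => by
    rw [Finset.mem_Icc] at hkab
    exact exists_mk_mem_of_mem_Icc hc ha hb ⟨by exact_mod_cast hkab.1, by exact_mod_cast hkab.2⟩
  have hset : P ∩ (integerPoints : Set (ℝ × ℝ)) =
      (fun q : (_ : ℤ) × ℤ => ((q.1 : ℝ), (q.2 : ℝ))) ''
        ((Finset.Icc a b).sigma fun k => Finset.Icc ⌈lower P k⌉ ⌊upper P k⌋ : Finset _) := by
    ext p
    constructor
    · rintro ⟨hp, i, j, rfl⟩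
      have h1 := ha.2 ⟨_, hp, rfl⟩
      have h2 := hb.2 ⟨_, hp, rfl⟩
      simp only [Int.cast_le] at h1 h2
      have hi : i ∈ Finset.Icc a b := Finset.mem_Icc.2 ⟨h1, h2⟩
      refine ⟨⟨i, j⟩, ?_, rfl⟩
      have := (mk_mem_iff hk hc (hex i hi)).1 hp
      simp only [Finset.coe_sigma, Set.mem_sigma_iff, Finset.mem_coe]
      exact ⟨hi, Finset.mem_Icc.2 ⟨Int.ceil_le.2 this.1, Int.le_floor.2 this.2⟩⟩
    · rintro ⟨⟨i, j⟩, hij, rfl⟩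
      simp only [Finset.coe_sigma, Set.mem_sigma_iff, Finset.mem_coe] at hij
      refine ⟨(mk_mem_iff hk hc (hex i hij.1)).2 ?_, i, j, rfl⟩
      have := Finset.mem_Icc.1 hij.2
      exact ⟨Int.ceil_le.1 this.1, Int.le_floor.1 this.2⟩
  have hinj : Function.Injective (fun q : (_ : ℤ) × ℤ => ((q.1 : ℝ), (q.2 : ℝ))) := by
    rintro ⟨i, j⟩ ⟨k, l⟩ h
    simp only [Prod.mk.injEq, Int.cast_inj] at h
    obtain ⟨rfl, rfl⟩ := h
    rfl
  rw [hset, Set.ncard_image_of_injective _ hinj, Set.ncard_coe_finset, Finset.card_sigma,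
    Nat.cast_sum]
  have hneg : sawtoothSum (-P) (-b) (-a) = ∑ k ∈ Finset.Icc a b, sawtooth (-lower P k) := by
    rw [sawtoothSum, ← sum_Icc_int_neg a b fun k => sawtooth (upper (-P) k)]
    refine Finset.sum_congr rfl fun k _ => ?_
    simp [lower]
  rw [hneg, sawtoothSum, ← Finset.sum_add_distrib, ← Finset.sum_add_distrib]
  refine Finset.sum_congr rfl fun k hkab => ?_
  have hlu : lower P k ≤ upper P k := lower_le hk (mk_upper_mem hk (hex k hkab))
  -- A column may miss the lattice; the difference is still at least `0`, so the truncation in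
  -- `toNat` is harmless.
  have hle : ⌈lower P k⌉ ≤ ⌊upper P k⌋ + 1 :=
    Int.ceil_le.2 (hlu.trans (by push_cast; exact (Int.lt_floor_add_one _).le))
  rw [Int.card_Icc]
  have : (((⌊upper P k⌋ + 1 - ⌈lower P k⌉).toNat : ℤ) : ℝ) =
      ((⌊upper P k⌋ + 1 - ⌈lower P k⌉ : ℤ) : ℝ) := by
    rw [Int.toNat_of_nonneg (by lia)]
  rw [Int.cast_natCast] at this
  rw [this]
  simp only [sawtooth, columnLength, Int.floor_neg]
  push_cast
  ring

end Columns

/-! ### Column lengths, area, and the counting formula. -/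

section Trapezoid

variable {P : Set (ℝ × ℝ)}

theorem exists_columnLength_eq (hP : IsLatticePolytope integerPoints P) {a b k : ℤ}
    (ha : IsLeast (Prod.fst '' P) (a : ℝ)) (hb : IsGreatest (Prod.fst '' P) (b : ℝ))
    (hk : k ∈ Finset.Ico a b) :
    ∃ σ : ℝ, ∀ x ∈ Set.Icc (k : ℝ) (k + 1),
      columnLength P x = columnLength P k + σ * (x - k) := by
  -- Negation carries the interval from `k` to `k + 1` to the one starting at `-k - 1`.
  have hk' : -k - 1 ∈ Finset.Ico (-b) (-a) := by
    rw [Finset.mem_Ico] at *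
    lia
  have h1 := fun x hx => upper_eq_of_mem_Icc hP ha hb hk (x := x) hx
  have h2 := fun x hx => upper_eq_of_mem_Icc hP.neg (isLeast_fst_neg hb) (isGreatest_fst_neg ha)
    hk' (x := x) hx
  refine ⟨upperSlope P k - upperSlope (-P) (-k - 1), fun x hx => ?_⟩
  have e1 := h1 x hx
  have e2 := h2 (-x) ⟨by push_cast; linarith [hx.2], by push_cast; linarith [hx.1]⟩
  have e3 := h2 (-k) ⟨by push_cast; linarith, by push_cast; linarith⟩
  simp only [columnLength, lower]
  rw [e1, e2, e3]
  push_cast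
  ring

theorem intervalIntegral_of_affine {g : ℝ → ℝ} {k σ : ℝ}
    (h : ∀ x ∈ Set.Icc k (k + 1), g x = g k + σ * (x - k)) :
    IntervalIntegrable g volume k (k + 1) ∧
      ∫ x in k..(k + 1), g x = (g k + g (k + 1)) / 2 := by
  have hle : k ≤ k + 1 := by linarith
  have hcont : Continuous fun x : ℝ => g k + σ * (x - k) := by fun_prop
  have hEq : Set.EqOn (fun x : ℝ => g k + σ * (x - k)) g (Set.uIcc k (k + 1)) := by
    intro x hx
    rw [Set.uIcc_of_le hle] at hx
    exact (h x hx).symm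
  refine ⟨(hcont.intervalIntegrable _ _).congr ?_, ?_⟩
  · exact hEq.mono Set.uIoc_subset_uIcc
  · rw [← intervalIntegral.integral_congr hEq, h (k + 1) ⟨hle, le_rfl⟩]
    have : ∀ x, HasDerivAt (fun x : ℝ => g k * x + σ * (x - k) ^ 2 / 2) (g k + σ * (x - k)) x := by
      intro x
      have h1 := ((hasDerivAt_id' x).const_mul (g k)).add
        (((((hasDerivAt_id' x).sub_const k).pow 2).const_mul σ).div_const 2)
      exact h1.congr_deriv (by push_cast; ring)
    rw [intervalIntegral.integral_eq_sub_of_hasDerivAt (fun x _ => this x)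
      (hcont.intervalIntegrable _ _)]
    ring

/-- The column length is affine on each unit interval, so the trapezoid rule is exact there. -/
theorem integral_columnLength (hP : IsLatticePolytope integerPoints P) {a b : ℤ}
    (ha : IsLeast (Prod.fst '' P) (a : ℝ)) (hb : IsGreatest (Prod.fst '' P) (b : ℝ)) :
    IntervalIntegrable (columnLength P) volume a b ∧
      ∫ x in (a : ℝ)..b, columnLength P x =
        ∑ k ∈ Finset.Icc a b, columnLength P k - (columnLength P a + columnLength P b) / 2 := by
  have hab := ha.le_of_isGreatest_fst hb
  obtain ⟨N, hN⟩ := Int.le.dest hab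
  have hstep : ∀ i < N, IntervalIntegrable (columnLength P) volume ((a : ℝ) + i)
      ((a : ℝ) + (i + 1 : ℕ)) ∧
      ∫ x in ((a : ℝ) + i)..((a : ℝ) + (i + 1 : ℕ)), columnLength P x =
        (columnLength P ((a : ℝ) + i) + columnLength P ((a : ℝ) + (i + 1 : ℕ))) / 2 := by
    intro i hi
    obtain ⟨σ, hσ⟩ := exists_columnLength_eq hP ha hb (k := a + i)
      (Finset.mem_Ico.2 ⟨by lia, by lia⟩)
    have := intervalIntegral_of_affine hσ
    push_cast at this ⊢
    rw [← add_assoc]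
    exact this
  have hbN : (b : ℝ) = a + N := by
    rw [← hN]
    push_cast
    rfl
  have hsum := intervalIntegral.sum_integral_adjacent_intervals
    (a := fun i : ℕ => (a : ℝ) + i) (n := N) (f := columnLength P) (μ := volume)
    fun i hi => (hstep i hi).1
  have hint := IntervalIntegrable.trans_iterate
    (a := fun i : ℕ => (a : ℝ) + i) (n := N) (f := columnLength P) (μ := volume)
    fun i hi => (hstep i hi).1
  simp only [Nat.cast_zero, add_zero, ← hbN] at hsum hint
  refine ⟨hint, ?_⟩
  rw [← hsum, Finset.sum_congr rfl fun i hi => (hstep i (Finset.mem_range.1 hi)).2,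
    sum_Icc_int_eq_add hab, sum_Ico_int_eq_sum_range hab, hbN]
  have : (b - a).toNat = N := by lia
  rw [this, ← Finset.sum_div, Finset.sum_add_distrib]
  have h1 := Finset.sum_range_succ (fun i : ℕ => columnLength P ((a : ℝ) + i)) N
  rw [Finset.sum_range_succ'] at h1
  push_cast at h1 ⊢
  rw [add_zero] at h1
  linarith

theorem volume_real_eq_integral (hP : IsLatticePolytope integerPoints P) {a b : ℤ}
    (ha : IsLeast (Prod.fst '' P) (a : ℝ)) (hb : IsGreatest (Prod.fst '' P) (b : ℝ)) :
    volume.real P = ∫ x in (a : ℝ)..b, columnLength P x := by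
  have hab : (a : ℝ) ≤ b := by exact_mod_cast ha.le_of_isGreatest_fst hb
  have hk := hP.isCompact
  have hc := hP.convex
  have hint := (integral_columnLength hP ha hb).1
  rw [intervalIntegrable_iff_integrableOn_Icc_of_le hab] at hint
  have hnn : ∀ x ∈ Set.Icc (a : ℝ) b, 0 ≤ columnLength P x := fun x hx =>
    sub_nonneg.2 (lower_le hk (mk_upper_mem hk (exists_mk_mem_of_mem_Icc hc ha hb hx)))
  rw [intervalIntegral.integral_of_le hab, ← integral_Icc_eq_integral_Ioc, Measure.real,
    Measure.volume_eq_prod, Measure.prod_apply hk.measurableSet,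
    integral_eq_lintegral_of_nonneg_ae _ hint.1]
  · rw [← lintegral_indicator measurableSet_Icc]
    congr 1
    refine lintegral_congr fun x => ?_
    by_cases hx : x ∈ Set.Icc (a : ℝ) b
    · rw [Set.indicator_of_mem hx, columnLength, ← Real.volume_Icc]
      congr 1
      ext y
      exact mk_mem_iff hk hc (exists_mk_mem_of_mem_Icc hc ha hb hx)
    · rw [Set.indicator_of_notMem hx]
      have : Prod.mk x ⁻¹' P = ∅ := by
        ext y
        simp only [Set.mem_preimage, Set.mem_empty_iff_false, iff_false]
        exact fun hy => hx ⟨ha.2 ⟨_, hy, rfl⟩, hb.2 ⟨_, hy, rfl⟩⟩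
      rw [this, measure_empty]
  · exact (ae_restrict_mem measurableSet_Icc).mono hnn

/-- The total length of the two vertical faces. -/
noncomputable def verticalFaces (P : Set (ℝ × ℝ)) : ℝ :=
  extent (ContinuousLinearMap.snd ℝ ℝ ℝ) (face P (ContinuousLinearMap.fst ℝ ℝ ℝ)) +
    extent (ContinuousLinearMap.snd ℝ ℝ ℝ) (face P (-ContinuousLinearMap.fst ℝ ℝ ℝ))

theorem extent_snd_column (hk : IsCompact P) (hc : Convex ℝ P) {x : ℝ} (hx : ∃ y, (x, y) ∈ P) :
    extent (ContinuousLinearMap.snd ℝ ℝ ℝ) {p ∈ P | p.1 = x} = columnLength P x := by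
  refine extent_eq_of_image_eq_Icc (lower_le hk (mk_upper_mem hk hx)) ?_
  ext y
  rw [← mk_mem_iff hk hc hx]
  constructor
  · rintro ⟨⟨p, q⟩, ⟨hp, rfl⟩, rfl⟩
    exact hp
  · intro h
    exact ⟨(x, y), ⟨h, rfl⟩, rfl⟩

theorem verticalFaces_eq (hP : IsLatticePolytope integerPoints P) {a b : ℤ}
    (ha : IsLeast (Prod.fst '' P) (a : ℝ)) (hb : IsGreatest (Prod.fst '' P) (b : ℝ)) :
    verticalFaces P = columnLength P a + columnLength P b := by
  have hk := hP.isCompact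
  have hc := hP.convex
  have hab : (a : ℝ) ≤ b := by exact_mod_cast ha.le_of_isGreatest_fst hb
  have h1 : face P (ContinuousLinearMap.fst ℝ ℝ ℝ) = {p ∈ P | p.1 = b} := by
    ext p
    refine ⟨fun h => ⟨h.1, ?_⟩, fun h => ⟨h.1, fun y hy => ?_⟩⟩
    · obtain ⟨q, hq, hqb⟩ := hb.1
      exact le_antisymm (hb.2 ⟨p, h.1, rfl⟩) (hqb ▸ h.2 q hq)
    · exact (hb.2 ⟨y, hy, rfl⟩).trans h.2.ge
  have h2 : face P (-ContinuousLinearMap.fst ℝ ℝ ℝ) = {p ∈ P | p.1 = a} := by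
    ext p
    refine ⟨fun h => ⟨h.1, ?_⟩, fun h => ⟨h.1, fun y hy => ?_⟩⟩
    · obtain ⟨q, hq, hqa⟩ := ha.1
      exact le_antisymm (hqa ▸ neg_le_neg_iff.1 (h.2 q hq)) (ha.2 ⟨p, h.1, rfl⟩)
    · exact neg_le_neg (h.2.le.trans (ha.2 ⟨y, hy, rfl⟩))
  rw [verticalFaces, h1, h2,
    extent_snd_column hk hc (exists_mk_mem_of_mem_Icc hc ha hb ⟨hab, le_rfl⟩),
    extent_snd_column hk hc (exists_mk_mem_of_mem_Icc hc ha hb ⟨le_rfl, hab⟩), add_comm]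

/-- This includes `a = b`: both vertical faces are then `P` itself, and half their total counts the
only column once. -/
theorem sum_columnLength_eq (hP : IsLatticePolytope integerPoints P) {a b : ℤ}
    (ha : IsLeast (Prod.fst '' P) (a : ℝ)) (hb : IsGreatest (Prod.fst '' P) (b : ℝ)) :
    ∑ k ∈ Finset.Icc a b, columnLength P k = volume.real P + verticalFaces P / 2 := by
  rw [volume_real_eq_integral hP ha hb, (integral_columnLength hP ha hb).2,
    verticalFaces_eq hP ha hb]
  ring

theorem extent_face_neg (z f : ℝ × ℝ →L[ℝ] ℝ) (hP : IsLatticePolytope integerPoints P)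
    (hzf : ∀ v, z v = 0 → f v = 0 → v = 0) :
    extent f (face (-P) z) = extent f (face P (-z)) := by
  obtain ⟨S, hne, hS, rfl⟩ := hP
  obtain ⟨x, -, y, -, h, -⟩ := exists_face_eq_segment hne (z := -z) (f := f)
    (fun v h1 h2 => hzf v (by simpa using h1) h2)
  have hneg : -(convexHull ℝ (S : Set (ℝ × ℝ))) =
      ContinuousLinearEquiv.neg ℝ '' convexHull ℝ (S : Set (ℝ × ℝ)) := by
    rw [← Set.image_neg_eq_neg]
    rfl
  have hz : z.comp (ContinuousLinearEquiv.neg ℝ : (ℝ × ℝ) ≃L[ℝ] ℝ × ℝ).toContinuousLinearMap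
      = -z := ContinuousLinearMap.ext fun v => map_neg z v
  have hf : f.comp (ContinuousLinearEquiv.neg ℝ : (ℝ × ℝ) ≃L[ℝ] ℝ × ℝ).toContinuousLinearMap
      = -f := ContinuousLinearMap.ext fun v => map_neg f v
  rw [hneg, face_image, extent_image, hz, hf, h, extent_segment, extent_segment, ← abs_neg]
  congr 1
  simp only [neg_apply]
  ring

/-- The number of integer points of an integer polygon is its area, plus a sum over pairs of
opposite faces of their total length with a weight for the direction, plus one. -/
theorem exists_card_integerPoints_eq (hP : IsLatticePolytope integerPoints P) :
    ∃ M : Finset ℝ, ∀ M', M ⊆ M' →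
      ((P ∩ (integerPoints : Set (ℝ × ℝ))).ncard : ℝ) =
        volume.real P + verticalFaces P / 2 + 1 +
        ∑ m ∈ M', (extent (ContinuousLinearMap.fst ℝ ℝ ℝ) (face P (slopeForm m)) +
          extent (ContinuousLinearMap.fst ℝ ℝ ℝ) (face P (-slopeForm m))) * sawtoothMean m := by
  classical
  obtain ⟨a, b, ha, hb⟩ := hP.exists_first_bounds
  obtain ⟨M₁, h₁⟩ := exists_sawtoothSum_eq hP ha hb
  obtain ⟨M₂, h₂⟩ := exists_sawtoothSum_eq hP.neg (isLeast_fst_neg hb) (isGreatest_fst_neg ha)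
  refine ⟨M₁ ∪ M₂, fun M' hM => ?_⟩
  rw [card_integerPoints_eq hP ha hb, sum_columnLength_eq hP ha hb,
    h₁ M' (Finset.union_subset_left hM), h₂ M' (Finset.union_subset_right hM)]
  have : ∀ m ∈ M', extent (ContinuousLinearMap.fst ℝ ℝ ℝ) (face (-P) (slopeForm m)) *
      sawtoothMean m = extent (ContinuousLinearMap.fst ℝ ℝ ℝ) (face P (-slopeForm m)) *
        sawtoothMean m := fun m _ => by
    rw [extent_face_neg _ _ hP fun v h1 h2 => ?_]
    have h2 : v.1 = 0 := h2
    rw [slopeForm_apply, h2] at h1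
    exact Prod.ext h2 (by simpa using h1)
  rw [Finset.sum_congr rfl this]
  simp only [add_mul, Finset.sum_add_distrib]
  ring

/-- Each of the two boundaries errs by at most `1 / 2` per column. The bound involves only the
width, so vertical stretching does not affect it. -/
theorem abs_card_integerPoints_sub_le (hP : IsLatticePolytope integerPoints P) {a b : ℤ}
    (ha : IsLeast (Prod.fst '' P) (a : ℝ)) (hb : IsGreatest (Prod.fst '' P) (b : ℝ)) :
    |((P ∩ (integerPoints : Set (ℝ × ℝ))).ncard : ℝ) -
      (volume.real P + verticalFaces P / 2)| ≤ b - a + 1 := by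
  have hab := ha.le_of_isGreatest_fst hb
  rw [card_integerPoints_eq hP ha hb, sum_columnLength_eq hP ha hb]
  have h1 := abs_sawtoothSum_le (P := P) hab
  have h2 := abs_sawtoothSum_le (P := -P) (neg_le_neg hab)
  push_cast at h2
  rw [abs_le] at *
  constructor <;> linarith

end Trapezoid

/-! ### Lattice coordinates and primitive functionals. -/

section Coordinates

theorem integerPoints_eq_span :
    integerPoints = Submodule.span ℤ (Set.range (Module.Basis.finTwoProd ℝ)) := by
  ext p
  rw [Module.Basis.mem_span_iff_repr_mem, Fin.forall_fin_two, mem_integerPoints]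
  constructor
  · rintro ⟨i, j, rfl⟩
    exact ⟨⟨i, by simp⟩, ⟨j, by simp⟩⟩
  · rintro ⟨⟨i, hi⟩, ⟨j, hj⟩⟩
    exact ⟨i, j, Prod.ext (by simpa using hi.symm) (by simpa using hj.symm)⟩

instance : DiscreteTopology integerPoints := by
  rw [integerPoints_eq_span]
  infer_instance

instance : IsZLattice ℝ integerPoints := by
  simp only [integerPoints_eq_span]
  infer_instance

variable {V : Type*} [NormedAddCommGroup V] [NormedSpace ℝ V]

/-- A `ℤ`-basis of the lattice is also a real basis of `V`. -/
theorem exists_coordinates (hV : Module.finrank ℝ V = 2) (Λ : Submodule ℤ V) [DiscreteTopology Λ]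
    [IsZLattice ℝ Λ] : ∃ T : V ≃L[ℝ] ℝ × ℝ, ∀ x, x ∈ Λ ↔ T x ∈ integerPoints := by
  have : FiniteDimensional ℝ V := Module.finite_of_finrank_pos (by rw [hV]; norm_num)
  have : ProperSpace V := FiniteDimensional.proper ℝ V
  have : Module.Finite ℤ Λ := ZLattice.module_finite ℝ Λ
  have : Module.Free ℤ Λ := ZLattice.module_free ℝ Λ
  have hr : Module.finrank ℤ Λ = 2 := by rw [ZLattice.rank ℝ, hV]
  let B := (Module.finBasisOfFinrankEq ℤ Λ hr).ofZLatticeBasis ℝ Λ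
  have hB : ∀ x, x ∈ Λ ↔ ∀ i, B.repr x i ∈ Set.range (algebraMap ℤ ℝ) := fun x => by
    rw [← Module.Basis.mem_span_iff_repr_mem, Module.Basis.ofZLatticeBasis_span]
  refine ⟨(B.equivFun.trans (LinearEquiv.finTwoArrow ℝ ℝ)).toContinuousLinearEquiv, fun x => ?_⟩
  rw [hB, Fin.forall_fin_two]
  have hT : (B.equivFun.trans (LinearEquiv.finTwoArrow ℝ ℝ)).toContinuousLinearEquiv x =
      (B.repr x 0, B.repr x 1) := by
    simp
  rw [hT, mem_integerPoints]
  constructor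
  · rintro ⟨⟨i, hi⟩, ⟨j, hj⟩⟩
    exact ⟨i, j, Prod.ext hi.symm hj.symm⟩
  · rintro ⟨i, j, hij⟩
    exact ⟨⟨i, (congrArg Prod.fst hij).symm⟩, ⟨j, (congrArg Prod.snd hij).symm⟩⟩

theorem comap_integerPoints_mem_superlattices {Ω : Submodule ℤ V} (T : V ≃L[ℝ] ℝ × ℝ)
    (h : ∀ x ∈ Ω, T x ∈ integerPoints) :
    ZLattice.comap ℝ integerPoints (T : V →ₗ[ℝ] ℝ × ℝ) ∈ superlattices Ω :=
  ⟨h, inferInstanceAs (DiscreteTopology (ZLattice.comap ℝ integerPoints T.toLinearMap)),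
    inferInstanceAs (IsZLattice ℝ (ZLattice.comap ℝ integerPoints T.toLinearMap))⟩

theorem ncard_inter_eq (T : V ≃L[ℝ] ℝ × ℝ) {Λ : Submodule ℤ V}
    (hT : ∀ x, x ∈ Λ ↔ T x ∈ integerPoints) (P : Set V) :
    (P ∩ (Λ : Set V)).ncard = (T '' P ∩ (integerPoints : Set (ℝ × ℝ))).ncard := by
  rw [← Set.ncard_image_of_injective _ T.injective]
  congr 1
  ext y
  constructor
  · rintro ⟨x, ⟨hx, hxΛ⟩, rfl⟩
    exact ⟨⟨x, hx, rfl⟩, (hT x).1 hxΛ⟩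
  · rintro ⟨⟨x, hx, rfl⟩, h⟩
    exact ⟨x, ⟨hx, (hT x).2 h⟩, rfl⟩

theorem exists_addHaar_eq_mul_volume (hV : Module.finrank ℝ V = 2) [MeasurableSpace V]
    [BorelSpace V] (area : Measure V) [area.IsAddHaarMeasure] (T : V ≃L[ℝ] ℝ × ℝ) :
    ∃ c : NNReal, c ≠ 0 ∧ ∀ P : Set V, area P = c * volume (T '' P) := by
  have : FiniteDimensional ℝ V := Module.finite_of_finrank_pos (by rw [hV]; norm_num)
  have : ProperSpace V := FiniteDimensional.proper ℝ V
  have : (volume.map T.symm : Measure V).IsAddHaarMeasure :=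
    T.symm.isAddHaarMeasure_map volume
  refine ⟨area.addHaarScalarFactor (volume.map T.symm),
    (Measure.addHaarScalarFactor_pos_of_isAddHaarMeasure _ _).ne', fun P => ?_⟩
  conv_lhs => rw [Measure.isAddLeftInvariant_eq_smul area (volume.map T.symm)]
  rw [Measure.smul_apply, ENNReal.smul_def, smul_eq_mul]
  congr 1
  have := T.symm.toHomeomorph.toMeasurableEquiv.map_apply (μ := volume) P
  refine this.trans ?_
  congr 1
  exact (T.image_eq_preimage_symm P).symm

/-- The functional with the coefficients `p` and `q` in the coordinates `T`. -/
noncomputable def coordForm (T : V ≃L[ℝ] ℝ × ℝ) (p q : ℝ) : V →L[ℝ] ℝ :=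
  (p • ContinuousLinearMap.fst ℝ ℝ ℝ + q • ContinuousLinearMap.snd ℝ ℝ ℝ).comp
    (T : V →L[ℝ] ℝ × ℝ)

@[simp] theorem coordForm_apply (T : V ≃L[ℝ] ℝ × ℝ) (p q : ℝ) (v : V) :
    coordForm T p q v = p * (T v).1 + q * (T v).2 := by
  simp [coordForm]

theorem coordForm_mem_dualLattice {Ω : Submodule ℤ V} {T : V ≃L[ℝ] ℝ × ℝ}
    (hT : ∀ x ∈ Ω, T x ∈ integerPoints) (p q : ℤ) : coordForm T p q ∈ dualLattice Ω := by
  intro x hx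
  obtain ⟨i, j, hij⟩ := hT x hx
  exact ⟨p * i + q * j, by rw [coordForm_apply, hij]; push_cast; rfl⟩

theorem exists_eq_coordForm {Ω : Submodule ℤ V} {T : V ≃L[ℝ] ℝ × ℝ}
    (hT : ∀ x, x ∈ Ω ↔ T x ∈ integerPoints) {z : V →L[ℝ] ℝ} (hz : z ∈ dualLattice Ω) :
    ∃ p q : ℤ, z = coordForm T p q := by
  obtain ⟨p, hp⟩ := hz (T.symm (1, 0)) ((hT _).2 ⟨1, 0, by simp⟩)
  obtain ⟨q, hq⟩ := hz (T.symm (0, 1)) ((hT _).2 ⟨0, 1, by simp⟩)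
  refine ⟨p, q, ContinuousLinearMap.ext fun v => ?_⟩
  have hv : v = (T v).1 • T.symm (1, 0) + (T v).2 • T.symm (0, 1) := by
    apply T.injective
    simp
  conv_lhs => rw [hv]
  rw [map_add, map_smul, map_smul, hp, hq, coordForm_apply, smul_eq_mul, smul_eq_mul]
  ring

theorem coordForm_injective {T : V ≃L[ℝ] ℝ × ℝ} {p q p' q' : ℤ}
    (h : coordForm T p q = coordForm T p' q') : p = p' ∧ q = q' := by
  constructor
  · have := DFunLike.congr_fun h (T.symm (1, 0))
    simpa using this
  · have := DFunLike.congr_fun h (T.symm (0, 1))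
    simpa using this

theorem coordForm_smul (T : V ≃L[ℝ] ℝ × ℝ) (c p q : ℝ) :
    coordForm T (c * p) (c * q) = c • coordForm T p q := by
  ext v
  simp
  ring

theorem isPrimitiveVector_coordForm_iff {Ω : Submodule ℤ V} {T : V ≃L[ℝ] ℝ × ℝ}
    (hT : ∀ x, x ∈ Ω ↔ T x ∈ integerPoints) {p q : ℤ} :
    IsPrimitiveVector (dualLattice Ω) (coordForm T p q) ↔ IsCoprime p q := by
  constructor
  · rintro ⟨hmem, hne, h⟩
    have hg := h (Int.gcd p q) (coordForm T ((p / Int.gcd p q : ℤ)) ((q / Int.gcd p q : ℤ)))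
      (coordForm_mem_dualLattice (fun x hx => (hT x).1 hx) _ _) (by
        rw [← Int.cast_smul_eq_zsmul ℝ, ← coordForm_smul]
        congr 1 <;> norm_cast
        · exact (Int.mul_ediv_cancel' (Int.gcd_dvd_left _ _)).symm
        · exact (Int.mul_ediv_cancel' (Int.gcd_dvd_right _ _)).symm)
    rw [Int.isCoprime_iff_gcd_eq_one]
    lia
  · intro h
    refine ⟨coordForm_mem_dualLattice (fun x hx => (hT x).1 hx) _ _, fun h0 => ?_, ?_⟩
    · have : coordForm T p q = coordForm T (0 : ℤ) (0 : ℤ) := by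
        rw [h0]
        ext
        simp
      obtain ⟨rfl, rfl⟩ := coordForm_injective this
      exact not_isCoprime_zero_zero h
    · intro k w hw hk
      obtain ⟨i, j, rfl⟩ := exists_eq_coordForm hT hw
      rw [← Int.cast_smul_eq_zsmul ℝ, ← coordForm_smul] at hk
      have : coordForm T p q = coordForm T (k * i : ℤ) (k * j : ℤ) := by
        push_cast
        exact hk
      obtain ⟨rfl, rfl⟩ := coordForm_injective this
      exact Int.isUnit_iff.1 (h.isUnit_of_dvd' (dvd_mul_right _ _) (dvd_mul_right _ _))

theorem exists_eq_smul_isPrimitiveVector {Ω : Submodule ℤ V} {T : V ≃L[ℝ] ℝ × ℝ}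
    (hT : ∀ x, x ∈ Ω ↔ T x ∈ integerPoints) {z : V →L[ℝ] ℝ} (hz : z ∈ dualLattice Ω)
    (h0 : z ≠ 0) :
    ∃ c : ℝ, 0 < c ∧ ∃ w, IsPrimitiveVector (dualLattice Ω) w ∧ z = c • w := by
  obtain ⟨p, q, rfl⟩ := exists_eq_coordForm hT hz
  have hpq : 0 < Int.gcd p q := by
    rw [Int.gcd_pos_iff]
    by_contra! h
    apply h0
    rw [h.1, h.2]
    ext
    simp
  refine ⟨Int.gcd p q, by exact_mod_cast hpq,
    coordForm T ((p / Int.gcd p q : ℤ)) ((q / Int.gcd p q : ℤ)),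
    (isPrimitiveVector_coordForm_iff hT).2 ?_, ?_⟩
  · rw [Int.isCoprime_iff_gcd_eq_one]
    exact Int.gcd_ediv_gcd_ediv_gcd hpq
  · rw [← coordForm_smul]
    congr 1 <;> norm_cast
    · exact (Int.mul_ediv_cancel' (Int.gcd_dvd_left _ _)).symm
    · exact (Int.mul_ediv_cancel' (Int.gcd_dvd_right _ _)).symm

/-- The unimodular map `(x, y) ↦ (p x + q y, u y - v x)`. -/
noncomputable def unimodularEquiv (p q u v : ℝ) (h : u * p + v * q = 1) :
    (ℝ × ℝ) ≃L[ℝ] ℝ × ℝ :=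
  LinearEquiv.toContinuousLinearEquiv
    { toFun := fun w => (p * w.1 + q * w.2, u * w.2 - v * w.1)
      invFun := fun w => (u * w.1 - q * w.2, v * w.1 + p * w.2)
      map_add' := fun w w' => by ext <;> simp <;> ring
      map_smul' := fun c w => by ext <;> simp <;> ring
      left_inv := fun w => Prod.ext (by simp only; linear_combination w.1 * h)
        (by simp only; linear_combination w.2 * h)
      right_inv := fun w => Prod.ext (by simp only; linear_combination w.1 * h)
        (by simp only; linear_combination w.2 * h) }

/-- Bézout coefficients complete the coprime coordinates of `z` to a unimodular matrix with `z` as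
first row. -/
theorem exists_adapted_coordinates {Ω : Submodule ℤ V} {T : V ≃L[ℝ] ℝ × ℝ}
    (hT : ∀ x, x ∈ Ω ↔ T x ∈ integerPoints) {z : V →L[ℝ] ℝ}
    (hz : IsPrimitiveVector (dualLattice Ω) z) :
    ∃ U : V ≃L[ℝ] ℝ × ℝ, (∀ x ∈ Ω, U x ∈ integerPoints) ∧
      (ContinuousLinearMap.fst ℝ ℝ ℝ).comp (U : V →L[ℝ] ℝ × ℝ) = z := by
  obtain ⟨p, q, rfl⟩ := exists_eq_coordForm hT hz.1
  obtain ⟨u, v, h⟩ := (isPrimitiveVector_coordForm_iff hT).1 hz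
  refine ⟨T.trans (unimodularEquiv p q u v (by exact_mod_cast h)), fun x hx => ?_, ?_⟩
  · obtain ⟨i, j, hij⟩ := (hT x).1 hx
    refine ⟨p * i + q * j, u * j - v * i, ?_⟩
    rw [ContinuousLinearEquiv.trans_apply, hij]
    push_cast
    rfl
  · ext x
    rw [coordForm_apply]
    rfl

end Coordinates

/-! ### Relative length as a multiple of extent. -/

section RelativeLength

variable {V : Type*} [NormedAddCommGroup V] [NormedSpace ℝ V] [MeasurableSpace V] [BorelSpace V]

theorem sectionCovolume_span_singleton_pos (hV : Module.finrank ℝ V = 2) (Ω : Submodule ℤ V)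
    [DiscreteTopology Ω] {w : V} (hw : w ∈ Ω) : 0 < sectionCovolume Ω (Submodule.span ℝ {w}) := by
  have : FiniteDimensional ℝ V := Module.finite_of_finrank_pos (by rw [hV]; norm_num)
  set W := Submodule.span ℝ {w}
  have : DiscreteTopology (ZLattice.comap ℝ Ω W.subtype) :=
    ZLattice.comap_discreteTopology ℝ Ω continuous_subtype_val W.subtype_injective
  have : IsZLattice ℝ (ZLattice.comap ℝ Ω W.subtype) := by
    refine ⟨?_⟩
    rw [eq_top_iff]
    rintro ⟨x, hx⟩ -
    obtain ⟨c, rfl⟩ := Submodule.mem_span_singleton.1 hx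
    have hwW : w ∈ W := Submodule.mem_span_singleton_self w
    exact Submodule.smul_mem _ c (Submodule.subset_span
      (show (⟨w, hwW⟩ : W) ∈ (ZLattice.comap ℝ Ω W.subtype : Set W) from hw))
  exact ZLattice.covolume_pos _ _

theorem relVol_segment (hV : Module.finrank ℝ V = 2) (Ω : Submodule ℤ V) {w x y : V} {c : ℝ}
    (hw : w ≠ 0) (hxy : y - x = c • w) :
    relVol Ω (segment ℝ x y) = ‖w‖ / sectionCovolume Ω (Submodule.span ℝ {w}) * |c| := by
  have hdir : (affineSpan ℝ (segment ℝ x y)).direction = Submodule.span ℝ {c • w} := by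
    rw [direction_affineSpan, vectorSpan_segment, vsub_eq_sub, hxy]
  rw [relVol, hdir, hV]
  by_cases hc : c = 0
  · subst hc
    -- For a point the direction has rank `0`, and the default value of `relVol` agrees with `|0|`.
    rw [if_neg (by rw [zero_smul, Submodule.span_zero_singleton, finrank_bot]; norm_num)]
    simp
  · have hspan : Submodule.span ℝ {c • w} = Submodule.span ℝ {w} :=
      Submodule.span_singleton_smul_eq (IsUnit.mk0 c hc) w
    rw [hspan, finrank_span_singleton hw, if_pos rfl, Nat.cast_one, Measure.real,
      hausdorffMeasure_segment, edist_dist, ENNReal.toReal_ofReal dist_nonneg, dist_comm,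
      dist_eq_norm, hxy, norm_smul, Real.norm_eq_abs]
    ring

/-- Both faces are parallel to the kernel of `z`, which contains a nonzero `w` in `Ω`. On segments
along `w`, `relVol` and `extent f` are both proportional to the multiple of `w`, so `κ` depends
neither on the polygon nor on the sign of `z`. -/
theorem exists_relVol_face_eq (hV : Module.finrank ℝ V = 2) {Ω : Submodule ℤ V}
    [DiscreteTopology Ω] [IsZLattice ℝ Ω] {z f : V →L[ℝ] ℝ} (hz : z ∈ dualLattice Ω)
    (h0 : z ≠ 0) (hzf : ∀ v, z v = 0 → f v = 0 → v = 0) :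
    ∃ κ : ℝ, 0 < κ ∧ ∀ P, IsLatticePolytope Ω P →
      relVol Ω (face P z) = κ * extent f (face P z) ∧
      relVol Ω (face P (-z)) = κ * extent f (face P (-z)) := by
  obtain ⟨T, hT⟩ := exists_coordinates hV Ω
  obtain ⟨w, hw, hw0, hzw⟩ : ∃ w ∈ Ω, w ≠ 0 ∧ z w = 0 := by
    obtain ⟨p, q, rfl⟩ := exists_eq_coordForm hT hz
    refine ⟨T.symm (q, -p), (hT _).2 ⟨q, -p, by simp⟩, fun h => h0 ?_, by simp; ring⟩
    rw [map_eq_zero_iff _ T.symm.injective, Prod.mk_eq_zero] at h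
    ext v
    rw [coordForm_apply, h.1, neg_eq_zero.1 h.2]
    simp
  have hfw : f w ≠ 0 := fun h => hw0 (hzf w hzw h)
  have hcov := sectionCovolume_span_singleton_pos hV Ω hw
  have hseg : ∀ x y, z x = z y → relVol Ω (segment ℝ x y) =
      ‖w‖ / sectionCovolume Ω (Submodule.span ℝ {w}) / |f w| * extent f (segment ℝ x y) := by
    intro x y hxy
    have : y - x = (f (y - x) / f w) • w := by
      rw [← sub_eq_zero]
      refine hzf _ ?_ ?_
      · simp [hzw, hxy]
      · simp [hfw]
    rw [relVol_segment hV Ω hw0 this, extent_segment, map_sub, abs_div]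
    ring
  refine ⟨‖w‖ / sectionCovolume Ω (Submodule.span ℝ {w}) / |f w|, ?_, ?_⟩
  · have := norm_pos_iff.2 hw0
    have := abs_pos.2 hfw
    positivity
  · rintro P ⟨S, hne, hS, rfl⟩
    constructor
    · obtain ⟨x, -, y, -, hface, -⟩ := exists_face_eq_segment hne hzf
      have hx := hface ▸ left_mem_segment ℝ x y
      have hy := hface ▸ right_mem_segment ℝ x y
      rw [hface]
      exact hseg x y (le_antisymm (hy.2 _ hx.1) (hx.2 _ hy.1))
    · obtain ⟨x, -, y, -, hface, -⟩ := exists_face_eq_segment hne (z := -z) (f := f)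
        fun v h1 h2 => hzf v (neg_eq_zero.1 h1) h2
      have hx := hface ▸ left_mem_segment ℝ x y
      have hy := hface ▸ right_mem_segment ℝ x y
      rw [hface]
      exact hseg x y (neg_injective (le_antisymm (hy.2 _ hx.1) (hx.2 _ hy.1)))

end RelativeLength

/-! ### Refined lattices and the two implications. -/

section Main

open scoped Pointwise in
theorem extent_smul {V : Type*} [NormedAddCommGroup V] [NormedSpace ℝ V] (f : V →L[ℝ] ℝ)
    (F : Set V) {c : ℝ} (hc : 0 ≤ c) : extent (c • f) F = c * extent f F := by
  have h : (c • f : V →L[ℝ] ℝ) '' F = c • (f '' F) := by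
    rw [← Set.image_smul, Set.image_image]
    rfl
  rw [extent, h, Real.sSup_smul_of_nonneg hc, Real.sInf_smul_of_nonneg hc, extent, smul_eq_mul,
    smul_eq_mul, mul_sub]

/-- The map `(x, y) ↦ (c x, d y)`. -/
noncomputable def diagEquiv (c d : ℝ) (hc : c ≠ 0) (hd : d ≠ 0) : (ℝ × ℝ) ≃L[ℝ] ℝ × ℝ :=
  (ContinuousLinearEquiv.unitsEquivAut ℝ (Units.mk0 c hc)).prodCongr
    (ContinuousLinearEquiv.unitsEquivAut ℝ (Units.mk0 d hd))

@[simp] theorem diagEquiv_apply (c d : ℝ) (hc : c ≠ 0) (hd : d ≠ 0) (p : ℝ × ℝ) :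
    diagEquiv c d hc hd p = (c * p.1, d * p.2) := by
  simp [diagEquiv, mul_comm]

theorem volume_real_diagEquiv_image {c d : ℝ} (hc : 0 < c) (hd : 0 < d) (P : Set (ℝ × ℝ)) :
    volume.real (diagEquiv c d hc.ne' hd.ne' '' P) = c * d * volume.real P := by
  have h : ⇑(diagEquiv c d hc.ne' hd.ne') =
      ((c • LinearMap.id : ℝ →ₗ[ℝ] ℝ).prodMap (d • LinearMap.id : ℝ →ₗ[ℝ] ℝ)) := by
    ext p <;> simp
  rw [Measure.real, h, Measure.addHaar_image_linearMap, LinearMap.det_prodMap,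
    LinearMap.det_smul, LinearMap.det_smul]
  simp only [Module.finrank_self, pow_one, LinearMap.det_id, mul_one]
  rw [abs_of_pos (mul_pos hc hd), ENNReal.toReal_mul,
    ENNReal.toReal_ofReal (mul_pos hc hd).le, Measure.real]

theorem verticalFaces_diagEquiv_image {c d : ℝ} (hc : 0 < c) (hd : 0 < d) (P : Set (ℝ × ℝ)) :
    verticalFaces (diagEquiv c d hc.ne' hd.ne' '' P) = d * verticalFaces P := by
  have h1 : (ContinuousLinearMap.fst ℝ ℝ ℝ).comp
      (diagEquiv c d hc.ne' hd.ne' : ℝ × ℝ →L[ℝ] ℝ × ℝ) = c • ContinuousLinearMap.fst ℝ ℝ ℝ :=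
    ContinuousLinearMap.ext fun p => by simp
  have h2 : (-ContinuousLinearMap.fst ℝ ℝ ℝ).comp
      (diagEquiv c d hc.ne' hd.ne' : ℝ × ℝ →L[ℝ] ℝ × ℝ) = c • -ContinuousLinearMap.fst ℝ ℝ ℝ :=
    ContinuousLinearMap.ext fun p => by simp
  have h3 : (ContinuousLinearMap.snd ℝ ℝ ℝ).comp
      (diagEquiv c d hc.ne' hd.ne' : ℝ × ℝ →L[ℝ] ℝ × ℝ) = d • ContinuousLinearMap.snd ℝ ℝ ℝ :=
    ContinuousLinearMap.ext fun p => by simp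
  rw [verticalFaces, face_image, face_image, extent_image, extent_image, h1, h2, h3,
    face_smul _ _ hc, face_smul _ _ hc, extent_smul _ _ hd.le, extent_smul _ _ hd.le,
    verticalFaces]
  ring

theorem verticalFaces_image {V : Type*} [NormedAddCommGroup V] [NormedSpace ℝ V]
    (T : V ≃L[ℝ] ℝ × ℝ) (P : Set V) :
    verticalFaces (T '' P) =
      extent ((ContinuousLinearMap.snd ℝ ℝ ℝ).comp (T : V →L[ℝ] ℝ × ℝ))
          (face P ((ContinuousLinearMap.fst ℝ ℝ ℝ).comp (T : V →L[ℝ] ℝ × ℝ))) +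
        extent ((ContinuousLinearMap.snd ℝ ℝ ℝ).comp (T : V →L[ℝ] ℝ × ℝ))
          (face P (-(ContinuousLinearMap.fst ℝ ℝ ℝ).comp (T : V →L[ℝ] ℝ × ℝ))) := by
  rw [verticalFaces, face_image, face_image, extent_image, extent_image]
  rfl

theorem diagEquiv_mem_integerPoints {c d : ℕ} (hc : (c : ℝ) ≠ 0) (hd : (d : ℝ) ≠ 0) {p : ℝ × ℝ}
    (hp : p ∈ integerPoints) : diagEquiv c d hc hd p ∈ integerPoints := by
  obtain ⟨i, j, rfl⟩ := hp
  exact ⟨c * i, d * j, by simp⟩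

theorem isLeast_fst_diagEquiv_image {P : Set (ℝ × ℝ)} {a : ℤ} {c d : ℕ} (hc : (c : ℝ) ≠ 0)
    (hd : (d : ℝ) ≠ 0) (ha : IsLeast (Prod.fst '' P) (a : ℝ)) :
    IsLeast (Prod.fst '' (diagEquiv c d hc hd '' P)) ((c * a : ℤ) : ℝ) := by
  obtain ⟨⟨p, hp, hpa⟩, ha⟩ := ha
  refine ⟨⟨_, ⟨p, hp, rfl⟩, by simp [hpa]⟩, ?_⟩
  rintro _ ⟨_, ⟨q, hq, rfl⟩, rfl⟩
  rw [diagEquiv_apply]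
  push_cast
  exact mul_le_mul_of_nonneg_left (ha ⟨q, hq, rfl⟩) (Nat.cast_nonneg c)

theorem isGreatest_fst_diagEquiv_image {P : Set (ℝ × ℝ)} {a : ℤ} {c d : ℕ} (hc : (c : ℝ) ≠ 0)
    (hd : (d : ℝ) ≠ 0) (ha : IsGreatest (Prod.fst '' P) (a : ℝ)) :
    IsGreatest (Prod.fst '' (diagEquiv c d hc hd '' P)) ((c * a : ℤ) : ℝ) := by
  obtain ⟨⟨p, hp, hpa⟩, ha⟩ := ha
  refine ⟨⟨_, ⟨p, hp, rfl⟩, by simp [hpa]⟩, ?_⟩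
  rintro _ ⟨_, ⟨q, hq, rfl⟩, rfl⟩
  rw [diagEquiv_apply]
  push_cast
  exact mul_le_mul_of_nonneg_left (ha ⟨q, hq, rfl⟩) (Nat.cast_nonneg c)

/-- The image has width `c * (b - a)`, so the error is free of `d` while the main term is linear in
`d`. -/
theorem exists_abs_card_diagEquiv_image_sub_le {P : Set (ℝ × ℝ)}
    (hP : IsLatticePolytope integerPoints P) {c : ℕ} (hc : (c : ℝ) ≠ 0) :
    ∃ C : ℝ, ∀ (d : ℕ) (hd : (d : ℝ) ≠ 0),
      |((diagEquiv c d hc hd '' P ∩ (integerPoints : Set (ℝ × ℝ))).ncard : ℝ) -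
        d * (c * volume.real P + verticalFaces P / 2)| ≤ C := by
  obtain ⟨a, b, ha, hb⟩ := hP.exists_first_bounds
  refine ⟨((c * b : ℤ) : ℝ) - ((c * a : ℤ) : ℝ) + 1, fun d hd => ?_⟩
  have hc0 : (0 : ℝ) < c := lt_of_le_of_ne (Nat.cast_nonneg c) hc.symm
  have hd0 : (0 : ℝ) < d := lt_of_le_of_ne (Nat.cast_nonneg d) hd.symm
  have h := abs_card_integerPoints_sub_le
    (hP.image (Λ := integerPoints) (diagEquiv c d hc hd)
      fun x hx => diagEquiv_mem_integerPoints hc hd hx)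
    (isLeast_fst_diagEquiv_image hc hd ha) (isGreatest_fst_diagEquiv_image hc hd hb)
  rw [volume_real_diagEquiv_image hc0 hd0, verticalFaces_diagEquiv_image hc0 hd0] at h
  convert h using 3
  ring

theorem eq_of_forall_nat_mul_abs_sub_le {x y C : ℝ}
    (h : ∀ d : ℕ, d ≠ 0 → d * |x - y| ≤ C) : x = y := by
  by_contra hne
  have hpos : 0 < |x - y| := abs_pos.2 (sub_ne_zero.2 hne)
  obtain ⟨n, hn⟩ := exists_nat_gt (C / |x - y|)
  rw [div_lt_iff₀ hpos] at hn
  have := h (n + 1) n.succ_ne_zero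
  push_cast at this
  linarith

variable {V : Type*} [NormedAddCommGroup V] [NormedSpace ℝ V]

theorem volume_and_verticalFaces_eq_of_universalCount_eq {Ω : Submodule ℤ V} {P Q : Set V}
    (hP : IsLatticePolytope Ω P) (hQ : IsLatticePolytope Ω Q)
    (h : universalCount Ω P = universalCount Ω Q) (T : V ≃L[ℝ] ℝ × ℝ)
    (hT : ∀ x ∈ Ω, T x ∈ integerPoints) :
    volume.real (T '' P) = volume.real (T '' Q) ∧
      verticalFaces (T '' P) = verticalFaces (T '' Q) := by
  have key : ∀ c : ℕ, (c : ℝ) ≠ 0 →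
      c * volume.real (T '' P) + verticalFaces (T '' P) / 2 =
        c * volume.real (T '' Q) + verticalFaces (T '' Q) / 2 := by
    intro c hc
    obtain ⟨A, hA⟩ := exists_abs_card_diagEquiv_image_sub_le (hP.image T hT) hc
    obtain ⟨B, hB⟩ := exists_abs_card_diagEquiv_image_sub_le (hQ.image T hT) hc
    refine eq_of_forall_nat_mul_abs_sub_le (C := A + B) fun d hd0 => ?_
    have hd : (d : ℝ) ≠ 0 := by exact_mod_cast hd0
    have hU : ∀ x ∈ Ω, T.trans (diagEquiv c d hc hd) x ∈ integerPoints := fun x hx =>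
      diagEquiv_mem_integerPoints hc hd (hT x hx)
    -- The test lattice is the pullback of `integerPoints`: in the coordinates `T`, spacing `1 / c`
    -- horizontally and `1 / d` vertically.
    have hcard := congrFun h ⟨_, comap_integerPoints_mem_superlattices _ hU⟩
    simp only [universalCount] at hcard
    rw [ncard_inter_eq (T.trans (diagEquiv c d hc hd)) (fun x => Iff.rfl) P,
      ncard_inter_eq (T.trans (diagEquiv c d hc hd)) (fun x => Iff.rfl) Q] at hcard
    have himage : ∀ F : Set V, T.trans (diagEquiv c d hc hd) '' F =
        diagEquiv c d hc hd '' (T '' F) := fun F => by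
      rw [Set.image_image]
      rfl
    rw [himage, himage] at hcard
    have h1 := hA d hd
    have h2 := hB d hd
    rw [hcard] at h1
    rw [← abs_of_nonneg (Nat.cast_nonneg d : (0 : ℝ) ≤ d), ← abs_mul, mul_sub]
    rw [abs_le] at *
    constructor <;> linarith
  -- Two values of `c` give a linear system that determines both unknowns.
  have h1 := key 1 (by norm_num)
  have h2 := key 2 (by norm_num)
  push_cast at h1 h2
  constructor <;> linarith

variable [MeasurableSpace V] [BorelSpace V]

/-- A positive multiple of a primitive vector has the same faces, so the hypothesis reaches every
nonzero `z` in the dual lattice and every transverse `f`. -/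
theorem extent_add_extent_eq (hV : Module.finrank ℝ V = 2) {Ω : Submodule ℤ V}
    [DiscreteTopology Ω] [IsZLattice ℝ Ω] {P Q : Set V} (hP : IsLatticePolytope Ω P)
    (hQ : IsLatticePolytope Ω Q)
    (h : ∀ z : V →L[ℝ] ℝ, IsPrimitiveVector (dualLattice Ω) z →
      relVol Ω (face P z) + relVol Ω (face P (-z)) = relVol Ω (face Q z) + relVol Ω (face Q (-z)))
    {z f : V →L[ℝ] ℝ} (hz : z ∈ dualLattice Ω) (h0 : z ≠ 0)
    (hzf : ∀ v, z v = 0 → f v = 0 → v = 0) :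
    extent f (face P z) + extent f (face P (-z)) =
      extent f (face Q z) + extent f (face Q (-z)) := by
  obtain ⟨T, hT⟩ := exists_coordinates hV Ω
  obtain ⟨c, hc, w, hw, rfl⟩ := exists_eq_smul_isPrimitiveVector hT hz h0
  obtain ⟨κ, hκ, hrel⟩ := exists_relVol_face_eq hV hz h0 hzf
  have hw' := h w hw
  rw [← face_smul P w hc, ← face_smul Q w hc, ← face_smul P (-w) hc, ← face_smul Q (-w) hc,
    smul_neg, (hrel P hP).1, (hrel P hP).2, (hrel Q hQ).1, (hrel Q hQ).2, ← mul_add,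
    ← mul_add] at hw'
  exact mul_left_cancel₀ hκ.ne' hw'

theorem universalCount_eq_of_area_eq (hV : Module.finrank ℝ V = 2) (area : Measure V)
    [area.IsAddHaarMeasure] {Ω : Submodule ℤ V}
    [DiscreteTopology Ω] [IsZLattice ℝ Ω] {P Q : Set V} (hP : IsLatticePolytope Ω P)
    (hQ : IsLatticePolytope Ω Q) (harea : area P = area Q)
    (h : ∀ z : V →L[ℝ] ℝ, IsPrimitiveVector (dualLattice Ω) z →
      relVol Ω (face P z) + relVol Ω (face P (-z)) =
        relVol Ω (face Q z) + relVol Ω (face Q (-z))) :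
    universalCount Ω P = universalCount Ω Q := by
  classical
  funext ⟨Λ, hle, hd, hl⟩
  -- The coordinates are adapted to `Λ`; since `Ω ≤ Λ`, functionals integral in them still lie in
  -- the dual lattice of `Ω`.
  obtain ⟨T, hT⟩ := exists_coordinates hV Λ
  have hTΩ : ∀ x ∈ Ω, T x ∈ integerPoints := fun x hx => (hT x).1 (hle hx)
  obtain ⟨M₁, h₁⟩ := exists_card_integerPoints_eq (hP.image T hTΩ)
  obtain ⟨M₂, h₂⟩ := exists_card_integerPoints_eq (hQ.image T hTΩ)
  simp only [universalCount]
  rw [ncard_inter_eq T hT, ncard_inter_eq T hT, ← Nat.cast_inj (R := ℝ),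
    h₁ (M₁ ∪ M₂) Finset.subset_union_left, h₂ (M₁ ∪ M₂) Finset.subset_union_right]
  congr 1
  · congr 2
    · obtain ⟨c, hc, hmul⟩ := exists_addHaar_eq_mul_volume hV area T
      rw [hmul, hmul, ENNReal.mul_right_inj (by exact_mod_cast hc) ENNReal.coe_ne_top] at harea
      rw [Measure.real, harea, Measure.real]
    · congr 1
      rw [verticalFaces_image, verticalFaces_image]
      refine extent_add_extent_eq hV hP hQ h ?_ ?_ ?_
      · intro x hx
        obtain ⟨i, j, hij⟩ := hTΩ x hx
        exact ⟨i, by simp [hij]⟩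
      · intro hz
        have := DFunLike.congr_fun hz (T.symm (1, 0))
        simp at this
      · intro v h1 h2
        exact T.map_eq_zero_iff.1 (Prod.ext h1 h2)
  · refine Finset.sum_congr rfl fun m _ => ?_
    by_cases hm : sawtoothMean m = 0
    · rw [hm, mul_zero, mul_zero]
    congr 1
    obtain ⟨N, i, hN, hmN⟩ := exists_mul_eq_of_sawtoothMean_ne_zero hm
    have hN' : (0 : ℝ) < N := by exact_mod_cast hN
    -- Clearing the denominator of the slope gives integer coefficients without changing the faces.
    have hcoord : (N : ℝ) • (slopeForm m).comp (T : V →L[ℝ] ℝ × ℝ) =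
        coordForm T (-i : ℤ) (N : ℤ) := by
      ext v
      simp
      linear_combination (-(T v).1) * hmN
    have hneg : (-slopeForm m).comp (T : V →L[ℝ] ℝ × ℝ) =
      -(slopeForm m).comp (T : V →L[ℝ] ℝ × ℝ) := rfl
    rw [face_image, face_image, face_image, face_image, extent_image, extent_image, extent_image,
      extent_image, hneg, ← face_smul P _ hN', ← face_smul Q _ hN', ← face_smul P (-_) hN',
      ← face_smul Q (-_) hN', smul_neg, hcoord]
    refine extent_add_extent_eq hV hP hQ h (coordForm_mem_dualLattice hTΩ _ _) ?_ ?_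
    · intro hz
      have := DFunLike.congr_fun hz (T.symm (0, 1))
      simp at this
      lia
    · intro v h1 h2
      have h2 : (T v).1 = 0 := h2
      rw [coordForm_apply, h2, mul_zero, zero_add] at h1
      have h3 := (mul_eq_zero.1 h1).resolve_left (by exact_mod_cast hN.ne')
      exact T.map_eq_zero_iff.1 (Prod.ext h2 h3)

theorem area_eq_of_universalCount_eq (hV : Module.finrank ℝ V = 2) (area : Measure V)
    [area.IsAddHaarMeasure] {Ω : Submodule ℤ V}
    [DiscreteTopology Ω] [IsZLattice ℝ Ω] {P Q : Set V} (hP : IsLatticePolytope Ω P)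
    (hQ : IsLatticePolytope Ω Q) (h : universalCount Ω P = universalCount Ω Q) :
    area P = area Q := by
  obtain ⟨T, hT⟩ := exists_coordinates hV Ω
  have hTΩ : ∀ x ∈ Ω, T x ∈ integerPoints := fun x hx => (hT x).1 hx
  have hvol := (volume_and_verticalFaces_eq_of_universalCount_eq hP hQ h T hTΩ).1
  obtain ⟨c, -, hmul⟩ := exists_addHaar_eq_mul_volume hV area T
  rw [hmul, hmul]
  congr 1
  -- Compactness makes both volumes finite, so equality of the real values suffices.
  exact (ENNReal.toReal_eq_toReal_iff' (hP.image T hTΩ).isCompact.measure_lt_top.ne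
    (hQ.image T hTΩ).isCompact.measure_lt_top.ne).1 hvol

theorem relVol_eq_of_universalCount_eq (hV : Module.finrank ℝ V = 2) {Ω : Submodule ℤ V}
    [DiscreteTopology Ω] [IsZLattice ℝ Ω] {P Q : Set V} (hP : IsLatticePolytope Ω P)
    (hQ : IsLatticePolytope Ω Q) (h : universalCount Ω P = universalCount Ω Q)
    {z : V →L[ℝ] ℝ} (hz : IsPrimitiveVector (dualLattice Ω) z) :
    relVol Ω (face P z) + relVol Ω (face P (-z)) =
      relVol Ω (face Q z) + relVol Ω (face Q (-z)) := by
  obtain ⟨T, hT⟩ := exists_coordinates hV Ω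
  obtain ⟨U, hU, rfl⟩ := exists_adapted_coordinates hT hz
  have hfaces := (volume_and_verticalFaces_eq_of_universalCount_eq hP hQ h U hU).2
  rw [verticalFaces_image, verticalFaces_image] at hfaces
  obtain ⟨κ, -, hrel⟩ := exists_relVol_face_eq hV hz.1 hz.2.1
    (f := (ContinuousLinearMap.snd ℝ ℝ ℝ).comp (U : V →L[ℝ] ℝ × ℝ))
    fun v h1 h2 => U.map_eq_zero_iff.1 (Prod.ext h1 h2)
  rw [(hrel P hP).1, (hrel P hP).2, (hrel Q hQ).1, (hrel Q hQ).2, ← mul_add, ← mul_add, hfaces]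

end Main

theorem proposition3 {V : Type*} [NormedAddCommGroup V] [NormedSpace ℝ V]
    [MeasurableSpace V] [BorelSpace V] (hV : Module.finrank ℝ V = 2)
    (area : Measure V) [area.IsAddHaarMeasure]
    (Ω : Submodule ℤ V) [DiscreteTopology Ω] [IsZLattice ℝ Ω]
    (P Q : Set V) (hP : IsLatticePolytope Ω P) (hQ : IsLatticePolytope Ω Q) :
    universalCount Ω P = universalCount Ω Q ↔
      area P = area Q ∧
        ∀ z : V →L[ℝ] ℝ, IsPrimitiveVector (dualLattice Ω) z →
          relVol Ω (face P z) + relVol Ω (face P (-z)) =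
            relVol Ω (face Q z) + relVol Ω (face Q (-z)) :=
  ⟨fun h => ⟨area_eq_of_universalCount_eq hV area hP hQ h,
    fun _ hz => relVol_eq_of_universalCount_eq hV hP hQ h hz⟩,
    fun h => universalCount_eq_of_area_eq hV area hP hQ h.1 h.2⟩
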